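/- A \emph{vector addition tree automaton} (VATA) consists of a finite ranked alphabet $F$, a finite set $Q$ of states, a dimension $k\in\mathbb N$, a finite set of rules $$f(\langle q_1,x_1\rangle,\dots,\langle q_n,x_n\rangle)\to\langle q,(x_1-y_1)+\dots+(x_n-y_n)+z\rangle$$ with $f\in F$ of rank $n\ge 0$, $q_1,\dots,q_n,q\in Q$ and $y_1,\dots,y_n,z\in\mathbb N^k$, and a finite set $C\subseteq Q\times\mathbb N^k$ of accepting configurations. Configurations are elements of $Q\times\mathbb N^k$. If the terms $t_1,\dots,t_n$ reach $\langle q_1,x_1\rangle,\dots,\langle q_n,x_n\rangle$ and $x_i\ge y_i$ (componentwise) for all $i$, then by the rule above the term $f(t_1,\dots,t_n)$ reaches $\langle q,\sum_i (x_i-y_i)+z\rangle$. A term is accepted if it reaches some configuration in $C$, and the automaton is \emph{non-empty} if it accepts some term. Let $\mathrm C^2[\downarrow,\downarrow^+,\to,\to^+,\tau_{com}]$ be the two-variable fragment of first-order logic with equality, extended by the counting quantifiers $\exists^{\ge n}$, $\exists^{\le n}$ ($n\in\mathbb N$), over arbitrary unary symbols, the binary symbols $\downarrow,\downarrow^+,\to,\to^+$,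 and arbitrary further (``common'') binary symbols $\tau_{com}$. Its sentences are interpreted over finite, unranked, ordered, nonempty trees, in which $\downarrow$ is the child relation, $\to$ the right-sibling relation, and $\downarrow^+,\to^+$ are their transitive closures, while the unary and common binary symbols are interpreted arbitrarily. The \emph{satisfiability problem} asks whether a given sentence has such a model. \textbf{Theorem.} The satisfiability problem for $\mathrm C^2[\downarrow,\downarrow^+,\to,\to^+,\tau_{com}]$ is at least as hard as checking non-emptiness of vector addition tree automata: there is a function, computable in polynomial time (all numbers being written in unary), that maps every VATA $\mathcal A$ to a sentence $\varphi_{\mathcal A}$ of $\mathrm C^2[\downarrow,\downarrow^+,\to,\to^+,\tau_{com}]$ such that $\mathcal A$ is non-empty if and only if $\varphi_{\mathcal A}$ is satisfiable. -/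

import Mathlib

/-! ## Programs with a step count, polynomial-time reductions -/

/-- Programs of a machine with finitely many stacks (numbered registers) over an alphabet `Γ` and a
finite control.  A test looks at the top symbol of one stack (`none` if the stack is empty). -/
inductive Prog (Γ : Type) : Type where
  | skip : Prog Γ
  | push (r : ℕ) (a : Γ) : Prog Γ
  | pop (r : ℕ) : Prog Γ
  | seq (p q : Prog Γ) : Prog Γ
  | ite (r : ℕ) (test : Option Γ → Bool) (p q : Prog Γ) : Prog Γ
  | loop (r : ℕ) (test : Option Γ → Bool) (p : Prog Γ) : Prog Γ

/-- `p.Runs s s' t`: started with stack contents `s`, the program `p` halts with stack contents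
`s'` after exactly `t` steps.  Each elementary instruction and each test is one step. -/
inductive Prog.Runs {Γ : Type} : Prog Γ → (ℕ → List Γ) → (ℕ → List Γ) → ℕ → Prop where
  | skip (s : ℕ → List Γ) : Prog.Runs Prog.skip s s 1
  | push (r : ℕ) (a : Γ) (s : ℕ → List Γ) :
      Prog.Runs (Prog.push r a) s (Function.update s r (a :: s r)) 1
  | pop (r : ℕ) (s : ℕ → List Γ) :
      Prog.Runs (Prog.pop r) s (Function.update s r (s r).tail) 1
  | seq {p q : Prog Γ} {s s' s'' : ℕ → List Γ} {t t' : ℕ} :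
      Prog.Runs p s s' t → Prog.Runs q s' s'' t' → Prog.Runs (Prog.seq p q) s s'' (t + t')
  | ite_true {r : ℕ} {test : Option Γ → Bool} {p q : Prog Γ} {s s' : ℕ → List Γ} {t : ℕ} :
      test (s r).head? = true → Prog.Runs p s s' t →
      Prog.Runs (Prog.ite r test p q) s s' (t + 1)
  | ite_false {r : ℕ} {test : Option Γ → Bool} {p q : Prog Γ} {s s' : ℕ → List Γ} {t : ℕ} :
      test (s r).head? = false → Prog.Runs q s s' t →
      Prog.Runs (Prog.ite r test p q) s s' (t + 1)
  | loop_exit {r : ℕ} {test : Option Γ → Bool} {p : Prog Γ} {s : ℕ → List Γ} :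
      test (s r).head? = false → Prog.Runs (Prog.loop r test p) s s 1
  | loop_step {r : ℕ} {test : Option Γ → Bool} {p : Prog Γ} {s s' s'' : ℕ → List Γ} {t t' : ℕ} :
      test (s r).head? = true → Prog.Runs p s s' t →
      Prog.Runs (Prog.loop r test p) s' s'' t' →
      Prog.Runs (Prog.loop r test p) s s'' (t + t' + 1)

/-- Stack `0` holds the input word, all other stacks are empty. -/
def Prog.start {Γ : Type} (w : List Γ) : ℕ → List Γ := fun r => if r = 0 then w else []

/-- The function `f` is computable in polynomial time with respect to the encodings `ea`, `eb` of
its arguments and values by words over a finite alphabet. -/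
def PolyTimeComputable {Γ α β : Type} [Finite Γ] (ea : α → List Γ) (eb : β → List Γ)
    (f : α → β) : Prop :=
  ∃ (p : Prog Γ) (P : Polynomial ℕ), ∀ a : α, ∃ (s : ℕ → List Γ) (t : ℕ),
    p.Runs (Prog.start (ea a)) s t ∧ s 0 = eb (f a) ∧ t ≤ P.eval (ea a).length

/-- Polynomial-time many-one reducibility of the decision problem `A` (with instances in `α`,
encoded by `ea`) to the decision problem `B` (with instances in `β`, encoded by `eb`). -/
def PolyTimeReducible {Γ α β : Type} [Finite Γ] (ea : α → List Γ) (eb : β → List Γ)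
    (A : α → Prop) (B : β → Prop) : Prop :=
  ∃ f : α → β, PolyTimeComputable ea eb f ∧ ∀ a : α, A a ↔ B (f a)

/-! ## Vector addition tree automata -/

/-- Terms over a ranked alphabet with `m` symbols. -/
inductive RankedTerm {m : ℕ} (rank : Fin m → ℕ) : Type where
  | node (f : Fin m) (args : Fin (rank f) → RankedTerm rank) : RankedTerm rank

/-- A transition rule `f(⟨q₁, x₁⟩, …, ⟨qₙ, xₙ⟩) → ⟨q, (x₁ - y₁) + ⋯ + (xₙ - yₙ) + z⟩`, where
`f = symbol` has rank `n`, `qᵢ = source i`, `yᵢ = loss i`, `q = target` and `z = gain`. -/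
structure VATARule {m : ℕ} (rank : Fin m → ℕ) (numStates dim : ℕ) : Type where
  symbol : Fin m
  source : Fin (rank symbol) → Fin numStates
  loss : Fin (rank symbol) → Fin dim → ℕ
  target : Fin numStates
  gain : Fin dim → ℕ

/-- Vector addition tree automata: a finite ranked alphabet, a finite set of states, a dimension
(the number of counters), a finite set of rules, a finite set of accepting configurations. -/
structure VATA : Type where
  numSymbols : ℕ
  rank : Fin numSymbols → ℕ
  numStates : ℕ
  dim : ℕ
  rules : List (VATARule rank numStates dim)
  accepting : List (Fin numStates × (Fin dim → ℕ))

/-- `A.Reaches t q x`: some run of `A` on the term `t` ends in the configuration `⟨q, x⟩`.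
A rule may be applied only if no counter becomes negative in `xᵢ - yᵢ`. -/
inductive VATA.Reaches (A : VATA) :
    RankedTerm A.rank → Fin A.numStates → (Fin A.dim → ℕ) → Prop where
  | step (r : VATARule A.rank A.numStates A.dim) (hr : r ∈ A.rules)
      (ts : Fin (A.rank r.symbol) → RankedTerm A.rank)
      (xs : Fin (A.rank r.symbol) → Fin A.dim → ℕ)
      (hreach : ∀ i, VATA.Reaches A (ts i) (r.source i) (xs i))
      (hloss : ∀ i c, r.loss i c ≤ xs i c) :
      VATA.Reaches A (RankedTerm.node r.symbol ts) r.target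
        (fun c => (∑ i, (xs i c - r.loss i c)) + r.gain c)

/-- `A` accepts the term `t`. -/
def VATA.Accepts (A : VATA) (t : RankedTerm A.rank) : Prop :=
  ∃ c ∈ A.accepting, A.Reaches t c.1 c.2

/-- The automaton accepts at least one term. -/
def VATA.NonEmpty (A : VATA) : Prop := ∃ t : RankedTerm A.rank, A.Accepts t

/-! ## Two-variable logic with counting quantifiers over finite ordered trees -/

/-- The two variables. -/
inductive Var : Type where
  | x : Var
  | y : Var
  deriving DecidableEq

/-- The navigational symbols: child, descendant, right sibling, following sibling. -/
inductive Nav : Type where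
  | child : Nav
  | desc : Nav
  | next : Nav
  | foll : Nav

/-- Formulas of two-variable logic with counting quantifiers.  The unary symbols and the common
binary symbols are numbered. -/
inductive C2Formula : Type where
  | eq (u v : Var) : C2Formula
  | unary (n : ℕ) (u : Var) : C2Formula
  | nav (s : Nav) (u v : Var) : C2Formula
  | common (n : ℕ) (u v : Var) : C2Formula
  | not (φ : C2Formula) : C2Formula
  | and (φ ψ : C2Formula) : C2Formula
  | or (φ ψ : C2Formula) : C2Formula
  | ex (v : Var) (φ : C2Formula) : C2Formula
  | all (v : Var) (φ : C2Formula) : C2Formula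
  | atLeast (k : ℕ) (v : Var) (φ : C2Formula) : C2Formula
  | atMost (k : ℕ) (v : Var) (φ : C2Formula) : C2Formula

/-- The variable `w` occurs free in the formula. -/
def C2Formula.Free (w : Var) : C2Formula → Prop
  | .eq u v => w = u ∨ w = v
  | .unary _ u => w = u
  | .nav _ u v => w = u ∨ w = v
  | .common _ u v => w = u ∨ w = v
  | .not φ => φ.Free w
  | .and φ ψ => φ.Free w ∨ ψ.Free w
  | .or φ ψ => φ.Free w ∨ ψ.Free w
  | .ex v φ => w ≠ v ∧ φ.Free w
  | .all v φ => w ≠ v ∧ φ.Free w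
  | .atLeast _ v φ => w ≠ v ∧ φ.Free w
  | .atMost _ v φ => w ≠ v ∧ φ.Free w

/-- Formulas without free variables. -/
def C2Sentence : Type := {φ : C2Formula // ∀ w, ¬ φ.Free w}

/-- Finite unranked ordered trees with interpretations of the unary and of the common binary
symbols.  The nodes form a tree domain: `u ++ [i]` is the `i`-th child of `u`, counted from the
left and starting at `0`. -/
structure TreeStructure : Type where
  dom : Finset (List ℕ)
  root_mem : [] ∈ dom
  parent_mem : ∀ (u : List ℕ) (i : ℕ), u ++ [i] ∈ dom → u ∈ dom
  left_mem : ∀ (u : List ℕ) (i : ℕ), u ++ [i + 1] ∈ dom → u ++ [i] ∈ dom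
  unary : ℕ → dom → Prop
  common : ℕ → dom → dom → Prop

/-- `w` is a child of `u`. -/
def TreeStructure.Child (T : TreeStructure) (u w : T.dom) : Prop :=
  ∃ i : ℕ, w.1 = u.1 ++ [i]

/-- `w` is the right sibling of `u`. -/
def TreeStructure.Next (T : TreeStructure) (u w : T.dom) : Prop :=
  ∃ (p : List ℕ) (i : ℕ), u.1 = p ++ [i] ∧ w.1 = p ++ [i + 1]

/-- The fixed interpretation of the navigational symbols. -/
def TreeStructure.navRel (T : TreeStructure) : Nav → T.dom → T.dom → Prop
  | .child => T.Child
  | .desc => Relation.TransGen T.Child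
  | .next => T.Next
  | .foll => Relation.TransGen T.Next

/-- `T.Sat φ e`: the formula `φ` holds in `T` under the assignment `e`. -/
def TreeStructure.Sat (T : TreeStructure) : C2Formula → (Var → T.dom) → Prop
  | .eq u v, e => e u = e v
  | .unary n u, e => T.unary n (e u)
  | .nav s u v, e => T.navRel s (e u) (e v)
  | .common n u v, e => T.common n (e u) (e v)
  | .not φ, e => ¬ T.Sat φ e
  | .and φ ψ, e => T.Sat φ e ∧ T.Sat ψ e
  | .or φ ψ, e => T.Sat φ e ∨ T.Sat ψ e
  | .ex v φ, e => ∃ a, T.Sat φ (Function.update e v a)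
  | .all v φ, e => ∀ a, T.Sat φ (Function.update e v a)
  | .atLeast k v φ, e => k ≤ Set.ncard {a | T.Sat φ (Function.update e v a)}
  | .atMost k v φ, e => Set.ncard {a | T.Sat φ (Function.update e v a)} ≤ k

/-- The sentence has a finite tree model. -/
def C2Sentence.Satisfiable (φ : C2Sentence) : Prop :=
  ∃ T : TreeStructure, ∀ e : Var → T.dom, T.Sat φ.1 e

/-! ## Encodings by words -/

/-- The finite alphabet of the encodings. -/
inductive CodeSym : Type where
  | tick | endNum | item | endList
  | varX | varY | eq | unary | child | desc | next | foll | common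
  | not | and | or | ex | all | atLeast | atMost

instance : Finite CodeSym :=
  Finite.of_injective (fun a : CodeSym => (⟨a.ctorIdx, by cases a <;> decide⟩ : Fin 20)) (by
    intro a b h
    cases a <;> cases b <;> first | rfl | exact absurd h (by decide))

/-- Natural numbers are written in unary. -/
def encNat (n : ℕ) : List CodeSym := List.replicate n CodeSym.tick ++ [CodeSym.endNum]

def encList {α : Type} (e : α → List CodeSym) : List α → List CodeSym
  | [] => [CodeSym.endList]
  | a :: l => CodeSym.item :: (e a ++ encList e l)

def encFun {α : Type} {n : ℕ} (e : α → List CodeSym) (v : Fin n → α) : List CodeSym :=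
  encList e (List.ofFn v)

def encFin {n : ℕ} (i : Fin n) : List CodeSym := encNat i

def VATARule.encode {m : ℕ} {rank : Fin m → ℕ} {numStates dim : ℕ}
    (r : VATARule rank numStates dim) : List CodeSym :=
  encFin r.symbol ++ (encFun encFin r.source ++ (encFun (encFun encNat) r.loss ++
    (encFin r.target ++ encFun encNat r.gain)))

def VATA.encode (A : VATA) : List CodeSym :=
  encFun encNat A.rank ++ (encNat A.numStates ++ (encNat A.dim ++
    (encList VATARule.encode A.rules ++
      encList (fun c => encFin c.1 ++ encFun encNat c.2) A.accepting)))

def Var.encode : Var → CodeSym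
  | .x => CodeSym.varX
  | .y => CodeSym.varY

def Nav.encode : Nav → CodeSym
  | .child => CodeSym.child
  | .desc => CodeSym.desc
  | .next => CodeSym.next
  | .foll => CodeSym.foll

/-- Prefix notation. -/
def C2Formula.encode : C2Formula → List CodeSym
  | .eq u v => [CodeSym.eq, u.encode, v.encode]
  | .unary n u => CodeSym.unary :: u.encode :: encNat n
  | .nav s u v => [s.encode, u.encode, v.encode]
  | .common n u v => CodeSym.common :: u.encode :: v.encode :: encNat n
  | .not φ => CodeSym.not :: φ.encode
  | .and φ ψ => CodeSym.and :: (φ.encode ++ ψ.encode)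
  | .or φ ψ => CodeSym.or :: (φ.encode ++ ψ.encode)
  | .ex v φ => CodeSym.ex :: v.encode :: φ.encode
  | .all v φ => CodeSym.all :: v.encode :: φ.encode
  | .atLeast k v φ => CodeSym.atLeast :: v.encode :: (encNat k ++ φ.encode)
  | .atMost k v φ => CodeSym.atMost :: v.encode :: (encNat k ++ φ.encode)

def C2Sentence.encode (φ : C2Sentence) : List CodeSym := φ.1.encode

/-! The encodings are unambiguous. -/

/-- The code words determine the encoded objects, also when followed by further symbols. -/
def PrefixCode {α : Type} (e : α → List CodeSym) : Prop :=
  ∀ (a b : α) (s t : List CodeSym), e a ++ s = e b ++ t → a = b ∧ s = t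

theorem prefixCode_encNat : PrefixCode encNat := by
  intro a
  induction a with
  | zero =>
    intro b s t h
    cases b <;> simp_all [encNat, List.replicate_succ]
  | succ a ih =>
    intro b s t h
    cases b with
    | zero => simp [encNat, List.replicate_succ] at h
    | succ b =>
      have := ih b s t (by simpa [encNat, List.replicate_succ] using h)
      simpa using this

theorem prefixCode_encFin {n : ℕ} : PrefixCode (encFin (n := n)) := by
  intro a b s t h
  obtain ⟨h1, h2⟩ := prefixCode_encNat a b s t h
  exact ⟨Fin.ext h1, h2⟩

theorem prefixCode_encList {α : Type} {e : α → List CodeSym} (he : PrefixCode e) :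
    PrefixCode (encList e) := by
  intro a
  induction a with
  | nil =>
    intro b s t h
    cases b <;> simp_all [encList]
  | cons a l ih =>
    intro b s t h
    cases b with
    | nil => simp [encList] at h
    | cons b l' =>
      simp only [encList, List.cons_append, List.append_assoc, List.cons.injEq, true_and] at h
      obtain ⟨h1, h2⟩ := he _ _ _ _ h
      obtain ⟨h3, h4⟩ := ih _ _ _ h2
      exact ⟨by rw [h1, h3], h4⟩

theorem prefixCode_encFun {α : Type} {n : ℕ} {e : α → List CodeSym} (he : PrefixCode e) :
    PrefixCode (encFun e (n := n)) := by
  intro a b s t h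
  obtain ⟨h1, h2⟩ := prefixCode_encList he _ _ _ _ h
  exact ⟨List.ofFn_injective h1, h2⟩

theorem prefixCode_rule {m : ℕ} {rank : Fin m → ℕ} {k d : ℕ} :
    PrefixCode (VATARule.encode (rank := rank) (numStates := k) (dim := d)) := by
  rintro ⟨f, q, y, q', z⟩ ⟨f', p, u, p', w⟩ s t h
  simp only [VATARule.encode, List.append_assoc] at h
  obtain ⟨rfl, h1⟩ := prefixCode_encFin _ _ _ _ h
  obtain ⟨rfl, h2⟩ := prefixCode_encFun prefixCode_encFin _ _ _ _ h1
  obtain ⟨rfl, h3⟩ := prefixCode_encFun (prefixCode_encFun prefixCode_encNat) _ _ _ _ h2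
  obtain ⟨rfl, h4⟩ := prefixCode_encFin _ _ _ _ h3
  obtain ⟨rfl, h5⟩ := prefixCode_encFun prefixCode_encNat _ _ _ _ h4
  exact ⟨rfl, h5⟩

theorem VATA.encode_injective : Function.Injective VATA.encode := by
  rintro ⟨m, rk, k, d, R, C⟩ ⟨m', rk', k', d', R', C'⟩ h
  simp only [VATA.encode] at h
  obtain ⟨h1, h⟩ := prefixCode_encList prefixCode_encNat _ _ _ _ h
  have hm : m = m' := by simpa using congrArg List.length h1
  subst hm
  obtain rfl := List.ofFn_injective h1
  obtain ⟨rfl, h⟩ := prefixCode_encNat _ _ _ _ h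
  obtain ⟨rfl, h⟩ := prefixCode_encNat _ _ _ _ h
  obtain ⟨rfl, h⟩ := prefixCode_encList prefixCode_rule _ _ _ _ h
  have hc : PrefixCode (fun c : Fin k × (Fin d → ℕ) => encFin c.1 ++ encFun encNat c.2) := by
    rintro ⟨a, v⟩ ⟨b, w⟩ s t h
    simp only [List.append_assoc] at h
    obtain ⟨rfl, h1⟩ := prefixCode_encFin _ _ _ _ h
    obtain ⟨rfl, h2⟩ := prefixCode_encFun prefixCode_encNat _ _ _ _ h1
    exact ⟨rfl, h2⟩
  obtain ⟨rfl, -⟩ := prefixCode_encList hc C C' [] [] (by simpa using h)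
  rfl

theorem Var.encode_injective : Function.Injective Var.encode := by
  intro u v h
  cases u <;> cases v <;> simp_all [Var.encode]

theorem Nav.encode_injective : Function.Injective Nav.encode := by
  intro u v h
  cases u <;> cases v <;> simp_all [Nav.encode]

theorem prefixCode_formula : PrefixCode C2Formula.encode := by
  intro a
  induction a with
  | eq u v =>
    intro b s t h
    cases b with
    | nav n _ _ => cases n <;> simp [C2Formula.encode, Nav.encode] at h
    | eq _ _ => simpa [C2Formula.encode, Var.encode_injective.eq_iff, and_assoc] using h
    | _ => simp [C2Formula.encode] at h
  | unary n u =>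
    intro b s t h
    cases b with
    | nav n _ _ => cases n <;> simp [C2Formula.encode, Nav.encode] at h
    | unary m v =>
      simp only [C2Formula.encode, List.cons_append, List.cons.injEq, true_and] at h
      obtain ⟨h1, h2⟩ := prefixCode_encNat _ _ _ _ h.2
      exact ⟨by rw [h1, Var.encode_injective h.1], h2⟩
    | _ => simp [C2Formula.encode] at h
  | nav n u v =>
    intro b s t h
    cases b with
    | nav _ _ _ =>
      simpa [C2Formula.encode, Var.encode_injective.eq_iff, Nav.encode_injective.eq_iff,
        and_assoc] using h
    | _ => cases n <;> simp [C2Formula.encode, Nav.encode] at h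
  | common n u v =>
    intro b s t h
    cases b with
    | nav n _ _ => cases n <;> simp [C2Formula.encode, Nav.encode] at h
    | common m u' v' =>
      simp only [C2Formula.encode, List.cons_append, List.cons.injEq, true_and] at h
      obtain ⟨h1, h2⟩ := prefixCode_encNat _ _ _ _ h.2.2
      exact ⟨by rw [h1, Var.encode_injective h.1, Var.encode_injective h.2.1], h2⟩
    | _ => simp [C2Formula.encode] at h
  | not φ ih =>
    intro b s t h
    cases b with
    | nav n _ _ => cases n <;> simp [C2Formula.encode, Nav.encode] at h
    | not ψ =>
      simp only [C2Formula.encode, List.cons_append, List.cons.injEq, true_and] at h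
      obtain ⟨h1, h2⟩ := ih _ _ _ h
      exact ⟨by rw [h1], h2⟩
    | _ => simp [C2Formula.encode] at h
  | and φ ψ ih ih' =>
    intro b s t h
    cases b with
    | nav n _ _ => cases n <;> simp [C2Formula.encode, Nav.encode] at h
    | and _ _ =>
      simp only [C2Formula.encode, List.cons_append, List.append_assoc, List.cons.injEq,
        true_and] at h
      obtain ⟨h1, h2⟩ := ih _ _ _ h
      obtain ⟨h3, h4⟩ := ih' _ _ _ h2
      exact ⟨by rw [h1, h3], h4⟩
    | _ => simp [C2Formula.encode] at h
  | or φ ψ ih ih' =>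
    intro b s t h
    cases b with
    | nav n _ _ => cases n <;> simp [C2Formula.encode, Nav.encode] at h
    | or _ _ =>
      simp only [C2Formula.encode, List.cons_append, List.append_assoc, List.cons.injEq,
        true_and] at h
      obtain ⟨h1, h2⟩ := ih _ _ _ h
      obtain ⟨h3, h4⟩ := ih' _ _ _ h2
      exact ⟨by rw [h1, h3], h4⟩
    | _ => simp [C2Formula.encode] at h
  | ex v φ ih =>
    intro b s t h
    cases b with
    | nav n _ _ => cases n <;> simp [C2Formula.encode, Nav.encode] at h
    | ex _ _ =>
      simp only [C2Formula.encode, List.cons_append, List.cons.injEq, true_and] at h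
      obtain ⟨h1, h2⟩ := ih _ _ _ h.2
      exact ⟨by rw [h1, Var.encode_injective h.1], h2⟩
    | _ => simp [C2Formula.encode] at h
  | all v φ ih =>
    intro b s t h
    cases b with
    | nav n _ _ => cases n <;> simp [C2Formula.encode, Nav.encode] at h
    | all _ _ =>
      simp only [C2Formula.encode, List.cons_append, List.cons.injEq, true_and] at h
      obtain ⟨h1, h2⟩ := ih _ _ _ h.2
      exact ⟨by rw [h1, Var.encode_injective h.1], h2⟩
    | _ => simp [C2Formula.encode] at h
  | atLeast k v φ ih =>
    intro b s t h
    cases b with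
    | nav n _ _ => cases n <;> simp [C2Formula.encode, Nav.encode] at h
    | atLeast _ _ _ =>
      simp only [C2Formula.encode, List.cons_append, List.append_assoc, List.cons.injEq,
        true_and] at h
      obtain ⟨h1, h2⟩ := prefixCode_encNat _ _ _ _ h.2
      obtain ⟨h3, h4⟩ := ih _ _ _ h2
      exact ⟨by rw [h1, h3, Var.encode_injective h.1], h4⟩
    | _ => simp [C2Formula.encode] at h
  | atMost k v φ ih =>
    intro b s t h
    cases b with
    | nav n _ _ => cases n <;> simp [C2Formula.encode, Nav.encode] at h
    | atMost _ _ _ =>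
      simp only [C2Formula.encode, List.cons_append, List.append_assoc, List.cons.injEq,
        true_and] at h
      obtain ⟨h1, h2⟩ := prefixCode_encNat _ _ _ _ h.2
      obtain ⟨h3, h4⟩ := ih _ _ _ h2
      exact ⟨by rw [h1, h3, Var.encode_injective h.1], h4⟩
    | _ => simp [C2Formula.encode] at h

theorem C2Sentence.encode_injective : Function.Injective C2Sentence.encode := by
  intro φ ψ h
  exact Subtype.ext (prefixCode_formula φ.1 ψ.1 [] [] (by simpa [C2Sentence.encode] using h)).1

/-! A model of the sentence is a run drawn as a tree. The nodes satisfying unary symbol `0` are rule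
applications; every other node is a leaf. The leaves of kind `1` attached to a step give its state
in unary, and a leaf of kind `2 + c` is a token of counter `c`, attached to the step whose gain
creates it. Common symbol `0` links each leaf to exactly one proper ancestor, the place where it is
consumed. Common symbol `1` orders the arguments of a step: the index of an argument is the number
of nodes related to it.

The value of a counter is never written down. At a step `w` it is the number of tokens strictly
below `w` that are consumed at `w` or above. Passing from an argument to its parent drops exactly
the tokens consumed at the argument, and their number is required to be the loss of the rule. Since
values are cardinalities, they cannot become negative. The requirements concern only a node, its
children, and pairs of a leaf and its consumer, so two variables and counting quantifiers express
them. The root must consume exactly an accepting vector.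

From models to runs, `TreeStructure.IsRun.reaches` works by induction on height. The counter
equation is the combination of `ncard_pendingAt_self` (subtract the loss) and
`ncard_pendingAt_eq_sum` (add over the arguments, add the gain).

From runs to models, a tree is built bottom-up, although the consumer of a token lies higher up and
is not built yet. `Labelling.exists_isRun` therefore proves more: the levels at which the remaining
tokens will be consumed can be prescribed by arbitrary multisets of the right sizes. Labels store
distances relative to the leaf, so subtrees are glued unchanged. `Labelling.IsRun.isRun_tree` then
gives the model.

For the running time, prefix notation lets the sentence be written during a single pass over the
code of the automaton, with unary counters for kinds and argument indices. Every list is handled by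
`Prog.runsWithin_readList`, and the total time is quadratic. -/

namespace C2Formula

/-! ### The sentence of an automaton -/

/-- Exactly `k` elements `v` satisfy `φ`. -/
def exactly (k : ℕ) (v : Var) (φ : C2Formula) : C2Formula :=
  .and (.atLeast k v φ) (.atMost k v φ)

/-- Conjunction of the formulas `F j a`, where `a` runs through a list and `j` is its index,
counted from a given start, and of a last formula. -/
def indexedAnd {α : Type} (F : ℕ → α → C2Formula) : ℕ → List α → C2Formula → C2Formula
  | _, [], φ => φ
  | j, a :: l, φ => .and (F j a) (indexedAnd F (j + 1) l φ)

/-- Disjunction of the formulas `F a`, where `a` runs through a list, and of a last formula. -/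
def listOr {α : Type} (F : α → C2Formula) : List α → C2Formula → C2Formula
  | [], φ => φ
  | a :: l, φ => .or (F a) (listOr F l φ)

/-- `u` represents a step of the run. -/
def run (u : Var) : C2Formula := .unary 0 u

/-- `v` is a leaf of kind `s` attached to the node `u`. -/
def attached (u v : Var) (s : ℕ) : C2Formula :=
  .and (.nav .child u v) (.and (.not (run v)) (.unary s v))

/-- `v` is a leaf of kind `s` consumed at the node `u`. -/
def consumed (u v : Var) (s : ℕ) : C2Formula :=
  .and (.common 0 v u) (.unary s v)

/-- The numbers of leaves of kinds `2`, `3`, ... consumed at `u` are the entries of `l`. -/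
def consumption (u v : Var) (l : List ℕ) : C2Formula :=
  indexedAnd (fun s k => exactly k v (consumed u v s)) 2 l (run u)

/-- The `i`-th argument of the step `x` satisfies `φ`. -/
def argument (i : ℕ) (φ : C2Formula) : C2Formula :=
  .ex .y (.and (.nav .child .x .y) (.and (run .y) (.and (exactly i .x (.common 1 .x .y)) φ)))

/-- The node `x` is a step with a rule given by lists of numbers. -/
def ruleStep (src : List ℕ) (loss : List (List ℕ)) (tgt : ℕ) (gain : List ℕ) : C2Formula :=
  indexedAnd (fun i q => argument i (exactly q .x (attached .y .x 1))) 0 src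
    (.and (exactly src.length .y (.and (.nav .child .x .y) (run .y)))
      (indexedAnd (fun i l => argument i (consumption .y .x l)) 0 loss
        (.and (exactly tgt .y (attached .x .y 1))
          (indexedAnd (fun s k => exactly k .y (attached .x .y s)) 2 gain (run .x)))))

/-- The node `x` has the given state and consumes the given numbers of tokens. -/
def configuration (q : ℕ) (l : List ℕ) : C2Formula :=
  .and (exactly q .y (attached .x .y 1)) (consumption .x .y l)

end C2Formula

open C2Formula

/-- The symbol is not recorded: its rank is the number of sources, and the term can be recovered
from the rules chosen at the steps. -/
def VATARule.formula {m : ℕ} {rank : Fin m → ℕ} {numStates dim : ℕ}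
    (r : VATARule rank numStates dim) : C2Formula :=
  ruleStep (List.ofFn fun i => (r.source i : ℕ)) (List.ofFn fun i => List.ofFn (r.loss i))
    r.target (List.ofFn r.gain)

/-- The formula that describes the accepting runs of `A`. -/
def VATA.formula (A : VATA) : C2Formula :=
  .and (.all .x (.all .y (.or (.not (.nav .child .x .y)) (run .x))))
    (.and (.all .x (.all .y (.or (.not (.common 0 .x .y))
      (.and (.not (run .x)) (.nav .desc .y .x)))))
      (.and (.all .x (.or (run .x) (exactly 1 .y (.common 0 .x .y))))
        (.and (.all .x (listOr VATARule.formula A.rules (.not (run .x))))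
          (.ex .x (.and (run .x) (.and (.not (.ex .y (.nav .child .y .x)))
            (listOr (fun c => configuration c.1 (List.ofFn c.2)) A.accepting
              (.not (run .x)))))))))

/-! ### Free variables -/

namespace C2Formula

theorem free_exactly {w v : Var} {k : ℕ} {φ : C2Formula} :
    (exactly k v φ).Free w ↔ w ≠ v ∧ φ.Free w := by
  simp [exactly, Free]

theorem not_free_indexedAnd {α : Type} {F : ℕ → α → C2Formula} {w : Var}
    (hF : ∀ j a, ¬ (F j a).Free w) {φ : C2Formula} (hφ : ¬ φ.Free w) :
    ∀ (l : List α) (j : ℕ), ¬ (indexedAnd F j l φ).Free w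
  | [], _ => hφ
  | a :: l, j => fun h => h.elim (hF j a) (not_free_indexedAnd hF hφ l (j + 1))

theorem not_free_listOr {α : Type} {F : α → C2Formula} {w : Var}
    (hF : ∀ a, ¬ (F a).Free w) {φ : C2Formula} (hφ : ¬ φ.Free w) :
    ∀ l : List α, ¬ (listOr F l φ).Free w
  | [] => hφ
  | a :: l => fun h => h.elim (hF a) (not_free_listOr hF hφ l)

theorem not_free_consumption {u v w : Var} (h : w ≠ u) (l : List ℕ) :
    ¬ (consumption u v l).Free w := by
  refine not_free_indexedAnd (fun j a => ?_) ?_ l 2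
  · simp only [free_exactly, consumed, Free]
    tauto
  · simpa [run, Free] using h

theorem not_free_ruleStep (src : List ℕ) (loss : List (List ℕ)) (tgt : ℕ) (gain : List ℕ) :
    ¬ (ruleStep src loss tgt gain).Free .y := by
  refine not_free_indexedAnd (fun j a => ?_) ?_ src 0
  · simp [argument, Free]
  · rintro (h | h)
    · simp [free_exactly] at h
    · refine not_free_indexedAnd (fun j a => ?_) ?_ loss 0 h
      · simp [argument, Free]
      · rintro (h | h)
        · simp [free_exactly] at h
        · refine not_free_indexedAnd (fun j a => ?_) ?_ gain 2 h
          · simp [free_exactly]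
          · simp [run, Free]

theorem not_free_configuration (q : ℕ) (l : List ℕ) : ¬ (configuration q l).Free .y := by
  rintro (h | h)
  · simp [free_exactly] at h
  · exact not_free_consumption (by decide) l h

end C2Formula

theorem VATA.not_free_formula (A : VATA) (w : Var) : ¬ A.formula.Free w := by
  -- Quantifiers around both disjunctions bind `.x`, so only `.y` needs an argument.
  have h1 := not_free_listOr (F := VATARule.formula) (w := .y) (φ := .not (run .x))
    (fun r => not_free_ruleStep _ _ _ _) (by simp [run, Free]) A.rules
  have h2 := not_free_listOr
    (F := fun c : Fin A.numStates × (Fin A.dim → ℕ) => configuration c.1 (List.ofFn c.2))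
    (w := .y) (φ := .not (run .x))
    (fun c => not_free_configuration _ _) (by simp [run, Free]) A.accepting
  cases w <;> simp [VATA.formula, Free, free_exactly, run] at h1 h2 ⊢
  tauto

/-- The sentence that describes the accepting runs of `A`. -/
def VATA.sentence (A : VATA) : C2Sentence := ⟨A.formula, A.not_free_formula⟩

/-! ## Running times -/

/-- Started with stack contents `s`, the program `p` halts with stack contents `s'` after at most
`T` steps. -/
def Prog.RunsWithin {Γ : Type} (p : Prog Γ) (s s' : ℕ → List Γ) (T : ℕ) : Prop :=
  ∃ t ≤ T, p.Runs s s' t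

namespace Prog

theorem RunsWithin.mono {Γ : Type} {p : Prog Γ} {s s' : ℕ → List Γ} {T T' : ℕ}
    (h : p.RunsWithin s s' T) (hT : T ≤ T') : p.RunsWithin s s' T' := by
  obtain ⟨t, ht, h⟩ := h
  exact ⟨t, ht.trans hT, h⟩

theorem RunsWithin.seq {Γ : Type} {p q : Prog Γ} {s s' s'' : ℕ → List Γ} {T T' : ℕ}
    (hp : p.RunsWithin s s' T) (hq : q.RunsWithin s' s'' T') :
    (p.seq q).RunsWithin s s'' (T + T') := by
  obtain ⟨t, ht, hp⟩ := hp
  obtain ⟨t', ht', hq⟩ := hq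
  exact ⟨t + t', by omega, .seq hp hq⟩

theorem RunsWithin.loop_exit {Γ : Type} {r : ℕ} {test : Option Γ → Bool} {p : Prog Γ}
    {s : ℕ → List Γ} (h : test (s r).head? = false) : (loop r test p).RunsWithin s s 1 :=
  ⟨1, le_rfl, .loop_exit h⟩

theorem RunsWithin.loop_step {Γ : Type} {r : ℕ} {test : Option Γ → Bool} {p : Prog Γ}
    {s s' s'' : ℕ → List Γ} {T T' : ℕ} (h : test (s r).head? = true)
    (hp : p.RunsWithin s s' T) (hq : (loop r test p).RunsWithin s' s'' T') :
    (loop r test p).RunsWithin s s'' (T + T' + 1) := by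
  obtain ⟨t, ht, hp⟩ := hp
  obtain ⟨t', ht', hq⟩ := hq
  exact ⟨t + t' + 1, by omega, .loop_step h hp hq⟩

theorem RunsWithin.push {Γ : Type} {r : ℕ} {a : Γ} {s s' : ℕ → List Γ}
    (h : Function.update s r (a :: s r) = s') : (push r a).RunsWithin s s' 1 :=
  ⟨1, le_rfl, h ▸ .push r a s⟩

theorem RunsWithin.pop {Γ : Type} {r : ℕ} {s s' : ℕ → List Γ}
    (h : Function.update s r (s r).tail = s') : (pop r).RunsWithin s s' 1 :=
  ⟨1, le_rfl, h ▸ .pop r s⟩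

end Prog

/-! ## Reading lists and writing formulas -/

namespace CodeSym

def isTick : Option CodeSym → Bool
  | some tick => true
  | _ => false

def isItem : Option CodeSym → Bool
  | some item => true
  | _ => false

end CodeSym

/-- Stack contents: the input that is left, the output written so far (the top of the stack is its
last letter), and four counters. -/
def memory (inp out : List CodeSym) (k c i t : ℕ) : ℕ → List CodeSym
  | 0 => inp
  | 1 => out.reverse
  | 2 => List.replicate k .tick
  | 3 => List.replicate c .tick
  | 4 => List.replicate i .tick
  | 5 => List.replicate t .tick
  | _ => []

section memory

variable (inp out : List CodeSym) (k c i t : ℕ)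

theorem update_memory_zero (w : List CodeSym) :
    Function.update (memory inp out k c i t) 0 w = memory w out k c i t := by
  funext r
  rcases r with _ | _ | _ | _ | _ | _ | r <;> rfl

theorem update_memory_one (a : CodeSym) :
    Function.update (memory inp out k c i t) 1 (a :: out.reverse) =
      memory inp (out ++ [a]) k c i t := by
  funext r
  rcases r with _ | _ | _ | _ | _ | _ | r <;> simp [memory]

theorem update_memory_two (n : ℕ) :
    Function.update (memory inp out k c i t) 2 (List.replicate n .tick) =
      memory inp out n c i t := by
  funext r
  rcases r with _ | _ | _ | _ | _ | _ | r <;> rfl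

theorem update_memory_three (n : ℕ) :
    Function.update (memory inp out k c i t) 3 (List.replicate n .tick) =
      memory inp out k n i t := by
  funext r
  rcases r with _ | _ | _ | _ | _ | _ | r <;> rfl

theorem update_memory_four (n : ℕ) :
    Function.update (memory inp out k c i t) 4 (List.replicate n .tick) =
      memory inp out k c n t := by
  funext r
  rcases r with _ | _ | _ | _ | _ | _ | r <;> rfl

theorem update_memory_five (n : ℕ) :
    Function.update (memory inp out k c i t) 5 (List.replicate n .tick) =
      memory inp out k c i n := by
  funext r
  rcases r with _ | _ | _ | _ | _ | _ | r <;> rfl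

end memory

namespace Prog

open CodeSym

section

variable {inp out : List CodeSym} {k c i t : ℕ}

theorem runsWithin_pop_input (a : CodeSym) :
    (pop 0).RunsWithin (memory (a :: inp) out k c i t) (memory inp out k c i t) 1 :=
  .pop (update_memory_zero ..)

theorem runsWithin_push_output (a : CodeSym) :
    (push 1 a).RunsWithin (memory inp out k c i t) (memory inp (out ++ [a]) k c i t) 1 :=
  .push (update_memory_one ..)

theorem runsWithin_push_two :
    (push 2 tick).RunsWithin (memory inp out k c i t) (memory inp out (k + 1) c i t) 1 :=
  .push (update_memory_two (n := k + 1) ..)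

theorem runsWithin_push_three :
    (push 3 tick).RunsWithin (memory inp out k c i t) (memory inp out k (c + 1) i t) 1 :=
  .push (update_memory_three (n := c + 1) ..)

theorem runsWithin_push_four :
    (push 4 tick).RunsWithin (memory inp out k c i t) (memory inp out k c (i + 1) t) 1 :=
  .push (update_memory_four (n := i + 1) ..)

theorem runsWithin_push_five :
    (push 5 tick).RunsWithin (memory inp out k c i t) (memory inp out k c i (t + 1)) 1 :=
  .push (update_memory_five (n := t + 1) ..)

theorem runsWithin_pop_two :
    (pop 2).RunsWithin (memory inp out (k + 1) c i t) (memory inp out k c i t) 1 :=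
  .pop (update_memory_two ..)

theorem runsWithin_pop_three :
    (pop 3).RunsWithin (memory inp out k (c + 1) i t) (memory inp out k c i t) 1 :=
  .pop (update_memory_three ..)

theorem runsWithin_pop_four :
    (pop 4).RunsWithin (memory inp out k c (i + 1) t) (memory inp out k c i t) 1 :=
  .pop (update_memory_four ..)

theorem runsWithin_pop_five :
    (pop 5).RunsWithin (memory inp out k c i (t + 1)) (memory inp out k c i t) 1 :=
  .pop (update_memory_five ..)

end

/-- Write a fixed word. -/
def emit : List CodeSym → Prog CodeSym
  | [] => skip
  | a :: w => seq (push 1 a) (emit w)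

theorem runsWithin_emit {inp : List CodeSym} {k c i t : ℕ} :
    ∀ w out : List CodeSym, (emit w).RunsWithin (memory inp out k c i t)
      (memory inp (out ++ w) k c i t) (w.length + 1)
  | [], out => by simpa using ⟨1, le_rfl, Runs.skip _⟩
  | a :: w, out => by
    have := (runsWithin_push_output a).seq
      (runsWithin_emit (inp := inp) (k := k) (c := c) (i := i) (t := t) w (out ++ [a]))
    simp only [List.append_assoc, List.singleton_append] at this
    exact this.mono (by simp only [List.length_cons]; omega)

/-- Read a number and write its ticks, with a copy on stack `2`. -/
def readTicks : Prog CodeSym :=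
  seq (loop 0 isTick (seq (pop 0) (seq (push 1 tick) (push 2 tick)))) (pop 0)

theorem runsWithin_readTicks {inp : List CodeSym} {c i t : ℕ} (n : ℕ) (out : List CodeSym)
    (k : ℕ) : readTicks.RunsWithin (memory (encNat n ++ inp) out k c i t)
      (memory inp (out ++ List.replicate n tick) (k + n) c i t) (4 * n + 2) := by
  suffices h : (loop 0 isTick (seq (pop 0) (seq (push 1 tick) (push 2 tick)))).RunsWithin
      (memory (encNat n ++ inp) out k c i t)
      (memory (endNum :: inp) (out ++ List.replicate n tick) (k + n) c i t) (4 * n + 1) from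
    h.seq (runsWithin_pop_input _)
  induction n generalizing out k with
  | zero => simpa [encNat] using RunsWithin.loop_exit (by rfl)
  | succ n ih =>
    have h := RunsWithin.loop_step (r := 0) (test := isTick)
      (s := memory (encNat (n + 1) ++ inp) out k c i t) (by rfl)
      ((runsWithin_pop_input _).seq ((runsWithin_push_output tick).seq runsWithin_push_two))
      (ih (out ++ [tick]) (k + 1))
    rw [List.append_assoc, List.singleton_append, ← List.replicate_succ, add_assoc, add_comm 1 n]
      at h
    exact h.mono (by omega)

/-- Read a number and forget it. -/
def skipNat : Prog CodeSym := seq (loop 0 isTick (pop 0)) (pop 0)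

theorem runsWithin_skipNat {inp out : List CodeSym} {k c i t : ℕ} (n : ℕ) :
    skipNat.RunsWithin (memory (encNat n ++ inp) out k c i t) (memory inp out k c i t)
      (2 * (encNat n).length) := by
  suffices h : (loop 0 isTick (pop 0)).RunsWithin (memory (encNat n ++ inp) out k c i t)
      (memory (endNum :: inp) out k c i t) (2 * n + 1) from
    (h.seq (runsWithin_pop_input _)).mono (by simp [encNat]; omega)
  induction n with
  | zero => exact RunsWithin.loop_exit (by rfl)
  | succ n ih =>
    exact (RunsWithin.loop_step (r := 0) (test := isTick)
      (s := memory (encNat (n + 1) ++ inp) out k c i t) (by rfl)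
      (runsWithin_pop_input _) ih).mono (by omega)

/-- Write the ticks of stack `2`, which is emptied. -/
def moveTicks : Prog CodeSym := loop 2 isTick (seq (pop 2) (push 1 tick))

theorem runsWithin_moveTicks {inp : List CodeSym} {c i t : ℕ} (k : ℕ) (out : List CodeSym) :
    moveTicks.RunsWithin (memory inp out k c i t)
      (memory inp (out ++ List.replicate k tick) 0 c i t) (3 * k + 1) := by
  induction k generalizing out with
  | zero => simpa [moveTicks] using RunsWithin.loop_exit (by rfl)
  | succ k ih =>
    have h := RunsWithin.loop_step (r := 2) (test := isTick)
      (s := memory inp out (k + 1) c i t) (by rfl)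
      (runsWithin_pop_two.seq (runsWithin_push_output tick)) (ih (out ++ [tick]))
    rw [List.append_assoc, List.singleton_append, ← List.replicate_succ] at h
    exact h.mono (by omega)

/-- Write the ticks of stack `r`, which is restored. -/
def copyTicks (r : ℕ) : Prog CodeSym :=
  seq (loop r isTick (seq (pop r) (seq (push 1 tick) (push 5 tick))))
    (loop 5 isTick (seq (pop 5) (push r tick)))

/-- Draining the stack costs four steps per tick and restoring it from stack `5` costs three, which
gives the factor `7`. Stack `5` must be empty at the start, and is empty again at the end. -/
theorem runsWithin_copyTicks_three {inp out : List CodeSym} {k i : ℕ} (c : ℕ) :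
    (copyTicks 3).RunsWithin (memory inp out k c i 0)
      (memory inp (out ++ List.replicate c tick) k c i 0) (7 * c + 2) := by
  have h1 : ∀ n t out, (loop 3 isTick (seq (pop 3) (seq (push 1 tick) (push 5 tick)))).RunsWithin
      (memory inp out k n i t) (memory inp (out ++ List.replicate n tick) k 0 i (t + n))
      (4 * n + 1) := by
    intro n
    induction n with
    | zero => intro t out; simpa using RunsWithin.loop_exit (by rfl)
    | succ n ih =>
      intro t out
      have h := RunsWithin.loop_step (r := 3) (test := isTick)
        (s := memory inp out k (n + 1) i t) (by rfl)
        (runsWithin_pop_three.seq ((runsWithin_push_output tick).seq runsWithin_push_five))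
        (ih (t + 1) (out ++ [tick]))
      rw [List.append_assoc, List.singleton_append, ← List.replicate_succ, add_assoc t,
        add_comm 1 n] at h
      exact h.mono (by omega)
  have h2 : ∀ n c out, (loop 5 isTick (seq (pop 5) (push 3 tick))).RunsWithin
      (memory inp out k c i n) (memory inp out k (c + n) i 0) (3 * n + 1) := by
    intro n
    induction n with
    | zero => intro c out; exact RunsWithin.loop_exit (by rfl)
    | succ n ih =>
      intro c out
      have h := RunsWithin.loop_step (r := 5) (test := isTick)
        (s := memory inp out k c i (n + 1)) (by rfl)
        (runsWithin_pop_five.seq runsWithin_push_three) (ih (c + 1) out)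
      rw [add_assoc c, add_comm 1 n] at h
      exact h.mono (by omega)
  have h := (h1 c 0 out).seq (h2 (0 + c) 0 _)
  simp only [zero_add] at h
  exact h.mono (by omega)

theorem runsWithin_copyTicks_four {inp out : List CodeSym} {k c : ℕ} (i : ℕ) :
    (copyTicks 4).RunsWithin (memory inp out k c i 0)
      (memory inp (out ++ List.replicate i tick) k c i 0) (7 * i + 2) := by
  have h1 : ∀ n t out, (loop 4 isTick (seq (pop 4) (seq (push 1 tick) (push 5 tick)))).RunsWithin
      (memory inp out k c n t) (memory inp (out ++ List.replicate n tick) k c 0 (t + n))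
      (4 * n + 1) := by
    intro n
    induction n with
    | zero => intro t out; simpa using RunsWithin.loop_exit (by rfl)
    | succ n ih =>
      intro t out
      have h := RunsWithin.loop_step (r := 4) (test := isTick)
        (s := memory inp out k c (n + 1) t) (by rfl)
        (runsWithin_pop_four.seq ((runsWithin_push_output tick).seq runsWithin_push_five))
        (ih (t + 1) (out ++ [tick]))
      rw [List.append_assoc, List.singleton_append, ← List.replicate_succ, add_assoc t,
        add_comm 1 n] at h
      exact h.mono (by omega)
  have h2 : ∀ n i out, (loop 5 isTick (seq (pop 5) (push 4 tick))).RunsWithin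
      (memory inp out k c i n) (memory inp out k c (i + n) 0) (3 * n + 1) := by
    intro n
    induction n with
    | zero => intro i out; exact RunsWithin.loop_exit (by rfl)
    | succ n ih =>
      intro i out
      have h := RunsWithin.loop_step (r := 5) (test := isTick)
        (s := memory inp out k c i (n + 1)) (by rfl)
        (runsWithin_pop_five.seq runsWithin_push_four) (ih (i + 1) out)
      rw [add_assoc i, add_comm 1 n] at h
      exact h.mono (by omega)
  have h := (h1 i 0 out).seq (h2 (0 + i) 0 _)
  simp only [zero_add] at h
  exact h.mono (by omega)

/-- Empty the stack `r`. -/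
def clear (r : ℕ) : Prog CodeSym := loop r isTick (pop r)

theorem runsWithin_clear_three {inp out : List CodeSym} {k i t : ℕ} (c : ℕ) :
    (clear 3).RunsWithin (memory inp out k c i t) (memory inp out k 0 i t) (2 * c + 1) := by
  induction c with
  | zero => exact RunsWithin.loop_exit (by rfl)
  | succ c ih =>
    exact (RunsWithin.loop_step (r := 3) (test := isTick)
      (s := memory inp out k (c + 1) i t) (by rfl) runsWithin_pop_three ih).mono (by omega)

theorem runsWithin_clear_four {inp out : List CodeSym} {k c t : ℕ} (i : ℕ) :
    (clear 4).RunsWithin (memory inp out k c i t) (memory inp out k c 0 t) (2 * i + 1) := by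
  induction i with
  | zero => exact RunsWithin.loop_exit (by rfl)
  | succ i ih =>
    exact (RunsWithin.loop_step (r := 4) (test := isTick)
      (s := memory inp out k c (i + 1) t) (by rfl) runsWithin_pop_four ih).mono (by omega)

end Prog

/-! ### Codes of iterated conjunctions and disjunctions -/

/-- The concatenation of the words `W j a`, where `a` runs through a list and `j` is its index,
counted from a given start. -/
def indexedConcat {α : Type} (W : ℕ → α → List CodeSym) : ℕ → List α → List CodeSym
  | _, [] => []
  | j, a :: l => W j a ++ indexedConcat W (j + 1) l

/-- In prefix notation each conjunct contributes a contiguous word, so a list can be translated item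
by item without knowing its length in advance. -/
theorem C2Formula.encode_indexedAnd {α : Type} (F : ℕ → α → C2Formula) (φ : C2Formula) :
    ∀ (j : ℕ) (l : List α), (indexedAnd F j l φ).encode =
      indexedConcat (fun j a => CodeSym.and :: (F j a).encode) j l ++ φ.encode
  | _, [] => rfl
  | j, a :: l => by
    simp [indexedAnd, indexedConcat, C2Formula.encode, encode_indexedAnd F φ (j + 1) l]

theorem C2Formula.encode_listOr {α : Type} (F : α → C2Formula) (φ : C2Formula) :
    ∀ (j : ℕ) (l : List α), (listOr F l φ).encode =
      indexedConcat (fun _ a => CodeSym.or :: (F a).encode) j l ++ φ.encode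
  | _, [] => rfl
  | j, a :: l => by
    simp [listOr, indexedConcat, C2Formula.encode, encode_listOr F φ (j + 1) l]

/-- This bounds list indices, hence the contents of the counters, by the length of the input. -/
theorem length_lt_length_encList {α : Type} (e : α → List CodeSym) :
    ∀ l : List α, l.length < (encList e l).length
  | [] => by simp [encList]
  | a :: l => by
    have := length_lt_length_encList e l
    simp only [encList, List.length_cons, List.length_append]
    omega

namespace Prog

open CodeSym

/-- Read a list, using `p` for its items. -/
def readList (p : Prog CodeSym) : Prog CodeSym :=
  seq (loop 0 isItem (seq (pop 0) p)) (pop 0)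

/-- The functions `fc` and `fi` give the contents of stacks `3` and `4` before the item with index
`j`. The bound `N` caps index plus code length, so `p` may take time proportional to the counters.
The additional `2` per letter pays for the loop test and the removal of the marker. -/
theorem runsWithin_readList {α : Type} {e : α → List CodeSym} {p : Prog CodeSym}
    {fc fi : ℕ → ℕ} {W : ℕ → α → List CodeSym} {D N : ℕ}
    (hp : ∀ j a inp out, j + (e a).length ≤ N →
      p.RunsWithin (memory (e a ++ inp) out 0 (fc j) (fi j) 0)
        (memory inp (out ++ W j a) 0 (fc (j + 1)) (fi (j + 1)) 0) (D * (e a).length))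
    (inp : List CodeSym) (l : List α) (j : ℕ) (out : List CodeSym)
    (hN : j + (encList e l).length ≤ N) :
    (readList p).RunsWithin (memory (encList e l ++ inp) out 0 (fc j) (fi j) 0)
      (memory inp (out ++ indexedConcat W j l) 0 (fc (j + l.length)) (fi (j + l.length)) 0)
      ((D + 2) * (encList e l).length) := by
  -- The step saved in this bound pays for the final removal of `endList`.
  suffices h : (loop 0 isItem (seq (pop 0) p)).RunsWithin
      (memory (encList e l ++ inp) out 0 (fc j) (fi j) 0)
      (memory (endList :: inp) (out ++ indexedConcat W j l) 0 (fc (j + l.length))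
        (fi (j + l.length)) 0) ((D + 2) * (encList e l).length - 1) from
    (h.seq (runsWithin_pop_input _)).mono (by
      have := length_lt_length_encList e l
      have := Nat.mul_le_mul_left (D + 2) (show 1 ≤ (encList e l).length by omega)
      omega)
  induction l generalizing j out with
  | nil =>
    have : (loop 0 isItem (seq (pop 0) p)).RunsWithin
      (memory (endList :: inp) out 0 (fc j) (fi j) 0)
      (memory (endList :: inp) out 0 (fc j) (fi j) 0) 1 := RunsWithin.loop_exit (by rfl)
    simpa [encList, indexedConcat] using this.mono (by omega)
  | cons a l ih =>
    simp only [encList, List.length_cons, List.length_append] at hN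
    have h := RunsWithin.loop_step (r := 0) (test := isItem)
      (s := memory (encList e (a :: l) ++ inp) out 0 (fc j) (fi j) 0) (by rfl)
      (((runsWithin_pop_input _).seq (by
        rw [List.append_eq, List.append_assoc]; exact hp j a _ out (by omega))))
      (ih (j + 1) (out ++ W j a) (by omega))
    rw [List.append_assoc, add_assoc j, add_comm 1] at h
    refine h.mono ?_
    have := length_lt_length_encList e l
    have := Nat.mul_le_mul_left (D + 2) (show 1 ≤ (encList e l).length by omega)
    simp only [encList, List.length_cons, List.length_append, mul_add, add_mul]
    rw [add_mul] at this
    omega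

/-- Read a number `k` and write the code of `exactly k v φ`, where the code of `φ` is `w` followed
by the number on stack `3`. -/
def readExactly (v : Var) (w : List CodeSym) : Prog CodeSym :=
  seq (emit [.and, .atLeast, v.encode]) (seq readTicks (seq (emit (endNum :: w))
    (seq (copyTicks 3) (seq (emit [endNum, .atMost, v.encode]) (seq moveTicks
      (seq (emit (endNum :: w)) (seq (copyTicks 3) (emit [endNum]))))))))

/-- The number `k` occurs twice in the output, which is why the first reading leaves a copy on stack
`2`. Two copies of stack `3` account for `14 * N`; the bound `11` is the length of `attachedHead`,
the longest prefix used. -/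
theorem runsWithin_readExactly {inp : List CodeSym} {i c N : ℕ} {v : Var} {w : List CodeSym}
    {φ : C2Formula} (hφ : φ.encode = w ++ encNat c) (hw : w.length ≤ 11) (hc : c ≤ N) (k : ℕ)
    (out : List CodeSym) :
    (readExactly v w).RunsWithin (memory (encNat k ++ inp) out 0 c i 0)
      (memory inp (out ++ (exactly k v φ).encode) 0 c i 0)
      ((14 * N + 50) * (encNat k).length) := by
  have h := (runsWithin_emit (inp := encNat k ++ inp) (k := 0) (c := c) (i := i) (t := 0)
      [.and, .atLeast, v.encode] out).seq
    ((runsWithin_readTicks k _ 0).seq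
    ((runsWithin_emit (endNum :: w) _).seq ((runsWithin_copyTicks_three c).seq
    ((runsWithin_emit [endNum, .atMost, v.encode] _).seq ((runsWithin_moveTicks (0 + k) _).seq
    ((runsWithin_emit (endNum :: w) _).seq ((runsWithin_copyTicks_three c).seq
    (runsWithin_emit [endNum] _))))))))
  have e : (exactly k v φ).encode = [CodeSym.and, .atLeast, v.encode] ++ (List.replicate k tick ++
      ((endNum :: w) ++ (List.replicate c tick ++ ([endNum, .atMost, v.encode] ++
        (List.replicate (0 + k) tick ++
          ((endNum :: w) ++ (List.replicate c tick ++ [endNum]))))))) := by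
    simp [exactly, C2Formula.encode, hφ, encNat]
  rw [e]
  simp only [List.append_assoc] at h ⊢
  refine h.mono ?_
  simp only [List.length_cons, List.length_nil, encNat, List.length_append, List.length_replicate]
  have : 0 ≤ N * k := Nat.zero_le _
  nlinarith

/-- Write the code of `exactly i v φ`, where `i` is the number on stack `4`. -/
def writeExactly (v : Var) (φ : C2Formula) : Prog CodeSym :=
  seq (emit [.and, .atLeast, v.encode]) (seq (copyTicks 4)
    (seq (emit (endNum :: φ.encode ++ [.atMost, v.encode])) (seq (copyTicks 4)
      (emit (endNum :: φ.encode)))))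

theorem runsWithin_writeExactly {inp : List CodeSym} {i c N : ℕ} {v : Var}
    {φ : C2Formula} (hw : φ.encode.length ≤ 8) (hi : i ≤ N) (out : List CodeSym) :
    (writeExactly v φ).RunsWithin (memory inp out 0 c i 0)
      (memory inp (out ++ (exactly i v φ).encode) 0 c i 0) (14 * N + 40) := by
  have h := (runsWithin_emit (inp := inp) (k := 0) (c := c) (i := i) (t := 0)
      [.and, .atLeast, v.encode] out).seq
    ((runsWithin_copyTicks_four i).seq
    ((runsWithin_emit (endNum :: φ.encode ++ [.atMost, v.encode]) _).seq
    ((runsWithin_copyTicks_four i).seq (runsWithin_emit (endNum :: φ.encode) _))))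
  have e : (exactly i v φ).encode = [CodeSym.and, .atLeast, v.encode] ++ (List.replicate i tick ++
      ((endNum :: φ.encode ++ [.atMost, v.encode]) ++ (List.replicate i tick ++
        (endNum :: φ.encode)))) := by
    simp [exactly, C2Formula.encode, encNat]
  rw [e]
  simp only [List.append_assoc] at h ⊢
  refine h.mono ?_
  simp only [List.length_cons, List.length_nil, List.length_append]
  omega

end Prog

/-! ### Programs for rules and accepting configurations -/

namespace Prog

open CodeSym

/-- Read a list of numbers and write the conjuncts `exactly k v (φ s)` for its entries `k`, where
the code of `φ s` is `w` followed by the number `s`, which is on stack `3`. -/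
def readEntries (v : Var) (w : List CodeSym) : Prog CodeSym :=
  readList (seq (emit [.and]) (seq (readExactly v w) (push 3 tick)))

theorem runsWithin_readEntries {i N : ℕ} {v : Var} {w : List CodeSym} {φ : ℕ → C2Formula}
    (hφ : ∀ s, (φ s).encode = w ++ encNat s) (hw : w.length ≤ 11) (inp : List CodeSym)
    (l : List ℕ) (j : ℕ) (out : List CodeSym) (hN : j + (encList encNat l).length ≤ N) :
    (readEntries v w).RunsWithin (memory (encList encNat l ++ inp) out 0 j i 0)
      (memory inp (out ++ indexedConcat (fun s k => CodeSym.and :: (exactly k v (φ s)).encode) j l)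
        0 (j + l.length) i 0) ((14 * N + 55) * (encList encNat l).length) := by
  refine runsWithin_readList (e := encNat) (fc := id) (fi := fun _ => i) (D := 14 * N + 53)
    (fun s k inp out hs => ?_) inp l j out hN
  have h := (runsWithin_emit (inp := encNat k ++ inp) (k := 0) (c := s) (i := i) (t := 0)
    [.and] out).seq
    ((runsWithin_readExactly (N := N) (v := v) (hφ s) hw (by omega) k _).seq runsWithin_push_three)
  simp only [List.append_assoc, List.singleton_append] at h
  refine h.mono ?_
  have : 1 ≤ (encNat k).length := by simp [encNat]
  simp only [List.length_singleton]
  linarith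

/-- The part of the code before the kind of the leaf; the kind is supplied from stack `3`. -/
def attachedHead (u v : Var) : List CodeSym :=
  [.and, .child, u.encode, v.encode, .and, .not, .unary, v.encode, endNum, .unary, v.encode]

theorem encode_attached (u v : Var) (s : ℕ) :
    (attached u v s).encode = attachedHead u v ++ encNat s := rfl

def consumedHead (u v : Var) : List CodeSym :=
  [.and, .common, v.encode, u.encode, endNum, .unary, v.encode]

theorem encode_consumed (u v : Var) (s : ℕ) :
    (consumed u v s).encode = consumedHead u v ++ encNat s := rfl

/-- Read a list and write the code of `consumption u v l`. -/
def readConsumption (u v : Var) : Prog CodeSym :=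
  seq (readEntries v (consumedHead u v)) (seq (emit (run u).encode) (clear 3))

theorem runsWithin_readConsumption {i N : ℕ} (u v : Var) (inp : List CodeSym)
    (l : List ℕ) (out : List CodeSym) (hN : (encList encNat l).length ≤ N) :
    (readConsumption u v).RunsWithin (memory (encList encNat l ++ inp) out 0 2 i 0)
      (memory inp (out ++ (consumption u v l).encode) 0 0 i 0)
      ((14 * N + 100) * (encList encNat l).length) := by
  -- Token kinds start at `2`, so the counter can exceed the list index by two.
  have h := (runsWithin_readEntries (N := N + 2) (i := i) (v := v) (encode_consumed u v)
    (by simp [consumedHead])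
    inp l 2 out (by omega)).seq
    ((runsWithin_emit (run u).encode _).seq (runsWithin_clear_three (2 + l.length)))
  rw [consumption, encode_indexedAnd, ← List.append_assoc]
  refine h.mono ?_
  have := length_lt_length_encList encNat l
  have e : (run u).encode.length = 3 := rfl
  rw [e]
  linarith

def argumentHead : List CodeSym :=
  [.and, .ex, varY, .and, .child, varX, varY, .and, .unary, varY, endNum, .and]

theorem encode_argument (i : ℕ) (φ : C2Formula) :
    CodeSym.and :: (argument i φ).encode = argumentHead ++
      ((exactly i .x (.common 1 .x .y)).encode ++ φ.encode) := rfl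

/-- Read an item of a list about the arguments of a rule, using `p`, and write what it says. -/
def readArgument (p : Prog CodeSym) : Prog CodeSym :=
  seq (emit argumentHead) (seq (writeExactly .x (.common 1 .x .y)) (seq p (push 4 tick)))

theorem runsWithin_readArgument {p : Prog CodeSym} {u inp out : List CodeSym} {c i N T : ℕ}
    {φ : C2Formula} (hi : i ≤ N)
    (hp : ∀ out, p.RunsWithin (memory (u ++ inp) out 0 c i 0)
      (memory inp (out ++ φ.encode) 0 c i 0) T) :
    (readArgument p).RunsWithin (memory (u ++ inp) out 0 c i 0)
      (memory inp (out ++ (CodeSym.and :: (argument i φ).encode)) 0 c (i + 1) 0)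
      (T + 14 * N + 54) := by
  have h := (runsWithin_emit (inp := u ++ inp) (k := 0) (c := c) (i := i) (t := 0)
    argumentHead out).seq
    ((runsWithin_writeExactly (v := .x) (φ := .common 1 .x .y) (by decide) hi _).seq
      ((hp _).seq runsWithin_push_four))
  rw [encode_argument]
  simp only [List.append_assoc] at h
  refine h.mono ?_
  have e : argumentHead.length = 12 := rfl
  rw [e]
  omega

def readSources : Prog CodeSym :=
  readList (readArgument (readExactly .x (attachedHead .y .x)))

theorem runsWithin_readSources {N : ℕ} (inp : List CodeSym) (l : List ℕ) (out : List CodeSym)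
    (hN : (encList encNat l).length ≤ N) :
    readSources.RunsWithin (memory (encList encNat l ++ inp) out 0 1 0 0)
      (memory inp (out ++ indexedConcat (fun i q => CodeSym.and ::
        (argument i (exactly q .x (attached .y .x 1))).encode) 0 l) 0 1 l.length 0)
      ((28 * N + 150) * (encList encNat l).length) := by
  have h := runsWithin_readList (e := encNat) (fc := fun _ => 1) (fi := id) (N := N)
    (D := 28 * N + 148)
    (W := fun i q => CodeSym.and :: (argument i (exactly q .x (attached .y .x 1))).encode)
    (p := readArgument (readExactly .x (attachedHead .y .x)))
    (fun i q inp out hs => by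
      refine (runsWithin_readArgument (N := N) (by simp only [id_eq]; omega) (fun out =>
        runsWithin_readExactly (N := N + 1) (encode_attached .y .x 1) (by rfl) (by omega)
          q out)).mono ?_
      have : 1 ≤ (encNat q).length := by simp [encNat]
      have := Nat.mul_le_mul_left N this
      linarith) inp l 0 out (by omega)
  simp only [zero_add, id_eq] at h
  exact h

/-- Reading one loss vector clears stack `3`; the two pushes reset it to the first token kind for
the next argument. -/
def readLosses : Prog CodeSym :=
  readList (readArgument (seq (readConsumption .y .x) (seq (push 3 tick) (push 3 tick))))

theorem runsWithin_readLosses {N : ℕ} (inp : List CodeSym) (l : List (List ℕ))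
    (out : List CodeSym) (hN : (encList (encList encNat) l).length ≤ N) :
    readLosses.RunsWithin (memory (encList (encList encNat) l ++ inp) out 0 2 0 0)
      (memory inp (out ++ indexedConcat (fun i l => CodeSym.and ::
        (argument i (consumption .y .x l)).encode) 0 l) 0 2 l.length 0)
      ((28 * N + 170) * (encList (encList encNat) l).length) := by
  have h := runsWithin_readList (e := encList encNat) (fc := fun _ => 2) (fi := id) (N := N)
    (D := 28 * N + 168)
    (W := fun i l => CodeSym.and :: (argument i (consumption .y .x l)).encode)
    (p := readArgument (seq (readConsumption .y .x) (seq (push 3 tick) (push 3 tick))))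
    (fun i q inp out hs => by
      refine (runsWithin_readArgument (N := N) (by simp only [id_eq]; omega) (fun out =>
        (runsWithin_readConsumption (N := N) .y .x inp q out (by omega)).seq
          (runsWithin_push_three.seq runsWithin_push_three))).mono ?_
      have : 1 ≤ (encList encNat q).length := by
        have := length_lt_length_encList encNat q
        omega
      have := Nat.mul_le_mul_left N this
      linarith) inp l 0 out (by omega)
  simp only [zero_add, id_eq] at h
  exact h

/-- Read a state and a list of gains. -/
def readTargetGain : Prog CodeSym :=
  seq (emit [.and]) (seq (push 3 tick) (seq (readExactly .y (attachedHead .x .y))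
    (seq (push 3 tick) (seq (readEntries .y (attachedHead .x .y))
      (seq (emit (run .x).encode) (clear 3))))))

theorem runsWithin_readTargetGain {N : ℕ} (inp : List CodeSym) (q : ℕ) (l : List ℕ)
    (out : List CodeSym) (hN : (encList encNat l).length ≤ N) :
    readTargetGain.RunsWithin (memory (encNat q ++ (encList encNat l ++ inp)) out 0 0 0 0)
      (memory inp (out ++ (C2Formula.and (exactly q .y (attached .x .y 1))
        (indexedAnd (fun s k => exactly k .y (attached .x .y s)) 2 l (run .x))).encode) 0 0 0 0)
      ((14 * N + 120) * ((encNat q).length + (encList encNat l).length)) := by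
  have h := (runsWithin_emit (inp := encNat q ++ (encList encNat l ++ inp)) (k := 0) (c := 0)
    (i := 0) (t := 0) [.and] out).seq (runsWithin_push_three.seq
    ((runsWithin_readExactly (N := N + 1) (v := .y) (encode_attached .x .y 1) (by rfl)
      (by omega) q _).seq
    (runsWithin_push_three.seq
    ((runsWithin_readEntries (N := N + 2) (i := 0) (v := .y) (encode_attached .x .y) (by rfl)
      inp l 2 _ (by omega)).seq
    ((runsWithin_emit (run .x).encode _).seq (runsWithin_clear_three (2 + l.length)))))))
  rw [C2Formula.encode, encode_indexedAnd]
  simp only [List.append_assoc, List.cons_append, List.nil_append] at h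
  refine h.mono ?_
  have := length_lt_length_encList encNat l
  have e : (run .x).encode.length = 3 := rfl
  have e' : [CodeSym.and].length = 1 := rfl
  rw [e, e']
  have : 1 ≤ (encNat q).length := by simp [encNat]
  linarith

/-- Read a rule and write its description. -/
def readRule : Prog CodeSym :=
  seq skipNat (seq (push 3 tick) (seq (emit [.or]) (seq readSources (seq (emit [.and])
    (seq (writeExactly .y (.and (.nav .child .x .y) (run .y))) (seq (clear 4)
    (seq (push 3 tick) (seq readLosses (seq (clear 4) (seq (clear 3) readTargetGain))))))))))

theorem runsWithin_readRule {N : ℕ} (inp : List CodeSym) (f : ℕ) (src : List ℕ)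
    (loss : List (List ℕ)) (tgt : ℕ) (gain : List ℕ) (out : List CodeSym) {u : List CodeSym}
    (hu : u = encNat f ++ (encList encNat src ++ (encList (encList encNat) loss ++
      (encNat tgt ++ encList encNat gain)))) (hN : u.length ≤ N) :
    readRule.RunsWithin (memory (u ++ inp) out 0 0 0 0)
      (memory inp (out ++ (CodeSym.or :: (ruleStep src loss tgt gain).encode)) 0 0 0 0)
      ((42 * N + 400) * u.length) := by
  subst hu
  simp only [List.length_append] at hN
  have h := (runsWithin_skipNat (inp := encList encNat src ++ (encList (encList encNat) loss ++
      (encNat tgt ++ (encList encNat gain ++ inp)))) (out := out) (k := 0) (c := 0) (i := 0)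
      (t := 0) f).seq
    (runsWithin_push_three.seq ((runsWithin_emit [.or] _).seq
    ((runsWithin_readSources (N := N) _ src _ (by omega)).seq
    ((runsWithin_emit [.and] _).seq
    -- After the sources, stack `4` holds their number, which is the arity to be written.
    ((runsWithin_writeExactly (N := N) (v := .y) (φ := .and (.nav .child .x .y) (run .y))
      (by decide) (by have := length_lt_length_encList encNat src; omega) _).seq
    ((runsWithin_clear_four _).seq (runsWithin_push_three.seq
    ((runsWithin_readLosses (N := N) _ loss _ (by omega)).seq
    ((runsWithin_clear_four _).seq ((runsWithin_clear_three _).seq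
    (runsWithin_readTargetGain (N := N) inp tgt gain _ (by omega))))))))))))
  have e : (ruleStep src loss tgt gain).encode =
      indexedConcat (fun i q => CodeSym.and ::
        (argument i (exactly q .x (attached .y .x 1))).encode) 0 src ++
      (CodeSym.and :: ((exactly src.length .y (.and (.nav .child .x .y) (run .y))).encode ++
      (indexedConcat (fun i l => CodeSym.and ::
        (argument i (consumption .y .x l)).encode) 0 loss ++
      (C2Formula.and (exactly tgt .y (attached .x .y 1))
        (indexedAnd (fun s k => exactly k .y (attached .x .y s)) 2 gain (run .x))).encode))) := by
    rw [ruleStep, encode_indexedAnd, C2Formula.encode, encode_indexedAnd]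
  rw [e]
  simp only [List.append_assoc, List.cons_append, List.nil_append] at h ⊢
  refine h.mono ?_
  have h1 := length_lt_length_encList encNat src
  have h2 := length_lt_length_encList (encList encNat) loss
  have h3 : 1 ≤ (encNat f).length := by simp [encNat]
  have h4 := Nat.mul_le_mul_left N h3
  have e' : [CodeSym.and].length = 1 := rfl
  have e'' : [CodeSym.or].length = 1 := rfl
  simp only [List.length_append, e', e'']
  have := Nat.zero_le (N * (encNat f).length)
  have := Nat.zero_le (N * (encNat tgt).length)
  have := Nat.zero_le (N * (encList encNat src).length)
  have := Nat.zero_le (N * (encList encNat gain).length)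
  have := Nat.zero_le (N * (encList (encList encNat) loss).length)
  linarith

/-- Read an accepting configuration and write its description. -/
def readAccepting : Prog CodeSym :=
  seq (emit [.or, .and]) (seq (push 3 tick) (seq (readExactly .y (attachedHead .x .y))
    (seq (push 3 tick) (readConsumption .x .y))))

theorem runsWithin_readAccepting {N : ℕ} (inp : List CodeSym) (q : ℕ) (l : List ℕ)
    (out : List CodeSym) {u : List CodeSym} (hu : u = encNat q ++ encList encNat l)
    (hN : u.length ≤ N) :
    readAccepting.RunsWithin (memory (u ++ inp) out 0 0 0 0)
      (memory inp (out ++ (CodeSym.or :: (configuration q l).encode)) 0 0 0 0)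
      ((14 * N + 200) * u.length) := by
  subst hu
  simp only [List.length_append] at hN
  have h := (runsWithin_emit (inp := encNat q ++ (encList encNat l ++ inp)) (k := 0) (c := 0)
    (i := 0) (t := 0) [.or, .and] out).seq (runsWithin_push_three.seq
    ((runsWithin_readExactly (N := N + 1) (v := .y) (encode_attached .x .y 1) (by rfl)
      (by omega) q _).seq
    (runsWithin_push_three.seq
    (runsWithin_readConsumption (N := N) .x .y inp l _ (by omega)))))
  rw [configuration, C2Formula.encode]
  simp only [List.append_assoc, List.cons_append, List.nil_append] at h ⊢
  refine h.mono ?_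
  have e : [CodeSym.or, .and].length = 2 := rfl
  have : 1 ≤ (encNat q).length := by simp [encNat]
  simp only [List.length_append, e]
  linarith

/-! ### Moving the output to stack 0 -/

/-- A step pushes at most one symbol. A time bound for writing is thus also a bound on the length of
the output. -/
theorem Runs.length_le {Γ : Type} {p : Prog Γ} {s s' : ℕ → List Γ} {t : ℕ} (h : p.Runs s s' t)
    (r : ℕ) : (s' r).length ≤ (s r).length + t := by
  induction h with
  | skip => omega
  | push r' a s =>
    by_cases e : r = r'
    · subst e; simp
    · simp [e]
  | pop r' s =>
    by_cases e : r = r'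
    · subst e; simp; omega
    · simp [e]
  | _ => omega

open Classical in
/-- Move the top symbol of stack `1` to stack `0` if it is in the list. -/
noncomputable def moveSymbol : List CodeSym → Prog CodeSym
  | [] => skip
  | a :: l => ite 1 (fun o => decide (o = some a)) (seq (pop 1) (push 0 a)) (moveSymbol l)

theorem runsWithin_moveSymbol {inp out : List CodeSym} {k c i t : ℕ} {a : CodeSym} :
    ∀ {l : List CodeSym}, a ∈ l →
      (moveSymbol l).RunsWithin (memory inp (out ++ [a]) k c i t)
        (memory (a :: inp) out k c i t) (l.length + 2)
  | b :: l, h => by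
    have htop : (memory inp (out ++ [a]) k c i t 1).head? = some a := by simp [memory]
    by_cases e : a = b
    · subst e
      have h1 : (pop 1).RunsWithin (memory inp (out ++ [a]) k c i t)
          (memory inp out k c i t) 1 := .pop (by
        funext r
        rcases r with _ | _ | _ | _ | _ | _ | r <;> simp [memory])
      have h2 : (push 0 a).RunsWithin (memory inp out k c i t)
          (memory (a :: inp) out k c i t) 1 := .push (update_memory_zero ..)
      obtain ⟨t, ht, h⟩ := h1.seq h2
      exact ⟨t + 1, by simp only [List.length_cons]; omega, .ite_true (by simp [htop]) h⟩
    · obtain ⟨t, ht, h⟩ := runsWithin_moveSymbol ((List.mem_cons.1 h).resolve_left e)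
      exact ⟨t + 1, by simp only [List.length_cons]; omega, .ite_false (by simp [htop, e]) h⟩

/-- Move the output to stack `0`. -/
noncomputable def moveOutput (l : List CodeSym) : Prog CodeSym :=
  loop 1 Option.isSome (moveSymbol l)

/-- The top of stack `1` is the last letter written, so moving letters one by one restores the
reading order. This forces the induction to proceed from the right end of the word. -/
theorem runsWithin_moveOutput {l : List CodeSym} (hl : ∀ a, a ∈ l) {k c i t : ℕ}
    (out inp : List CodeSym) :
    (moveOutput l).RunsWithin (memory inp out k c i t) (memory (out ++ inp) [] k c i t)
      ((l.length + 3) * out.length + 1) := by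
  induction out using List.reverseRecOn generalizing inp with
  | nil => exact (RunsWithin.loop_exit (by rfl)).mono (by simp)
  | append_singleton out a ih =>
    have h := RunsWithin.loop_step (r := 1) (test := Option.isSome)
      (s := memory inp (out ++ [a]) k c i t) (by simp [memory])
      (runsWithin_moveSymbol (hl a)) (ih (a :: inp))
    simp only [List.append_assoc, List.singleton_append]
    exact h.mono (by simp only [List.length_append, List.length_singleton]; linarith)

end Prog

theorem encList_map {α β : Type} (e : β → List CodeSym) (f : α → β) :
    ∀ l : List α, encList e (l.map f) = encList (fun a => e (f a)) l
  | [] => rfl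
  | a :: l => by simp [encList, encList_map e f l]

/-- The programs see lists of numbers; dependent vectors and `Fin` bounds leave no trace in the
code. -/
theorem VATARule.encode_eq {m : ℕ} {rank : Fin m → ℕ} {numStates dim : ℕ}
    (r : VATARule rank numStates dim) :
    r.encode = encNat r.symbol ++ (encList encNat (List.ofFn fun i => (r.source i : ℕ)) ++
      (encList (encList encNat) (List.ofFn fun i => List.ofFn (r.loss i)) ++
        (encNat r.target ++ encList encNat (List.ofFn r.gain)))) := by
  have h1 : encList encNat (List.ofFn fun i => (r.source i : ℕ)) = encFun encFin r.source := by
    rw [encFun, show (fun i => (r.source i : ℕ)) = Fin.val ∘ r.source from rfl, ← List.map_ofFn,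
      encList_map]
    rfl
  have h2 : encList (encList encNat) (List.ofFn fun i => List.ofFn (r.loss i)) =
      encFun (encFun encNat) r.loss := by
    rw [encFun, show (fun i => List.ofFn (r.loss i)) = List.ofFn ∘ r.loss from rfl,
      ← List.map_ofFn, encList_map]
    rfl
  rw [h1, h2]
  rfl

/-! ### The complete program and its running time -/

namespace Prog

open CodeSym

/-- The code of the formula up to the descriptions of the rules. -/
def formulaHead : List CodeSym :=
  .and :: ((C2Formula.all .x (.all .y (.or (.not (.nav .child .x .y)) (run .x)))).encode ++
    .and :: ((C2Formula.all .x
        (.all .y (.or (.not (.common 0 .x .y)) (.and (.not (run .x)) (.nav .desc .y .x))))).encode ++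
      .and :: ((C2Formula.all .x (.or (run .x) (exactly 1 .y (.common 0 .x .y)))).encode ++
        [.and, .all, .varX])))

/-- The code between the descriptions of the rules and of the accepting configurations. -/
def formulaMiddle : List CodeSym :=
  (C2Formula.not (run .x)).encode ++ ([.ex, .varX, .and] ++ ((run .x).encode ++
    ([.and] ++ (C2Formula.not (.ex .y (.nav .child .y .x))).encode)))

theorem encode_formula (A : VATA) : A.formula.encode = formulaHead ++
    (indexedConcat (fun _ r => CodeSym.or :: (VATARule.formula r).encode) 0 A.rules ++
    (formulaMiddle ++ (indexedConcat (fun _ c => CodeSym.or ::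
      (configuration c.1 (List.ofFn c.2)).encode) 0 A.accepting ++
        (C2Formula.not (run .x)).encode))) := by
  simp only [VATA.formula, C2Formula.encode, encode_listOr _ _ 0, formulaHead, formulaMiddle,
    List.append_assoc, List.cons_append, List.nil_append]
  rfl

theorem length_formulaHead : formulaHead.length ≤ 60 := by decide

theorem length_formulaMiddle : formulaMiddle.length ≤ 60 := by decide

/-- Write the formula of an automaton on stack `1`. -/
def writeFormula : Prog CodeSym :=
  seq (emit formulaHead) (seq (readList skipNat) (seq skipNat (seq skipNat
    (seq (readList readRule) (seq (emit formulaMiddle) (seq (readList readAccepting)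
      (emit (C2Formula.not (run .x)).encode)))))))

theorem runsWithin_writeFormula (A : VATA) {N : ℕ} (hN : A.encode.length ≤ N) :
    writeFormula.RunsWithin (memory A.encode [] 0 0 0 0) (memory [] A.formula.encode 0 0 0 0)
      ((42 * N + 600) * A.encode.length) := by
  set u1 := encFun encNat A.rank with hu1
  set u4 := encList VATARule.encode A.rules with hu4
  set u5 := encList (fun c : Fin A.numStates × (Fin A.dim → ℕ) =>
    encFin c.1 ++ encFun encNat c.2) A.accepting with hu5
  have e : A.encode = u1 ++ (encNat A.numStates ++ (encNat A.dim ++ (u4 ++ u5))) := rfl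
  have hu : u1.length + ((encNat A.numStates).length + ((encNat A.dim).length +
      (u4.length + u5.length))) ≤ N := by simpa [e] using hN
  -- The table of ranks is skipped: each item writes the empty word.
  have h1 := fun out inp => runsWithin_readList (e := encNat) (p := skipNat) (fc := fun _ => 0)
    (fi := fun _ => 0) (W := fun _ _ => []) (D := 2) (N := N)
    (fun j a inp out _ => by simpa using runsWithin_skipNat a) inp (List.ofFn A.rank) 0 out
    (by rw [← encFun, ← hu1]; omega)
  have h0 : ∀ (l : List ℕ) j, indexedConcat (fun _ _ => []) j l = [] := by
    intro l
    induction l with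
    | nil => exact fun _ => rfl
    | cons a l ih => exact fun j => ih (j + 1)
  simp only [h0, List.append_nil] at h1
  have h4 := fun out inp => runsWithin_readList (e := VATARule.encode) (p := readRule)
    (fc := fun _ => 0) (fi := fun _ => 0)
    (W := fun _ r => CodeSym.or :: (VATARule.formula r).encode) (D := 42 * N + 400) (N := N)
    (fun j r inp out hj =>
      runsWithin_readRule inp _ _ _ _ _ out r.encode_eq (le_trans (Nat.le_add_left _ _) hj))
    inp A.rules 0 out (by rw [← hu4]; omega)
  have h5 := fun out inp => runsWithin_readList
    (e := fun c : Fin A.numStates × (Fin A.dim → ℕ) => encFin c.1 ++ encFun encNat c.2)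
    (p := readAccepting) (fc := fun _ => 0) (fi := fun _ => 0)
    (W := fun _ c => CodeSym.or :: (configuration c.1 (List.ofFn c.2)).encode)
    (D := 14 * N + 200) (N := N)
    (fun j c inp out hj =>
      runsWithin_readAccepting inp _ _ out rfl (le_trans (Nat.le_add_left _ _) hj))
    inp A.accepting 0 out (by rw [← hu5]; omega)
  have h := (runsWithin_emit formulaHead []).seq ((h1 _ _).seq
    ((runsWithin_skipNat A.numStates).seq ((runsWithin_skipNat A.dim).seq
    ((h4 _ _).seq ((runsWithin_emit formulaMiddle _).seq ((h5 _ []).seq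
    (runsWithin_emit (C2Formula.not (run .x)).encode _)))))))
  rw [encode_formula, e]
  simp only [List.append_assoc, List.nil_append, List.append_nil] at h ⊢
  refine h.mono ?_
  have l1 : 1 ≤ u1.length := by
    have := length_lt_length_encList encNat (List.ofFn A.rank)
    rw [hu1, encFun]
    omega
  have l2 := length_formulaHead
  have l3 := length_formulaMiddle
  have l4 : (C2Formula.not (run .x)).encode.length = 4 := rfl
  rw [l4, ← encFun, ← hu1]
  simp only [List.length_append]
  have := Nat.zero_le (N * u1.length)
  have := Nat.zero_le (N * u4.length)
  have := Nat.zero_le (N * u5.length)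
  have := Nat.zero_le (N * (encNat A.numStates).length)
  have := Nat.zero_le (N * (encNat A.dim).length)
  linarith

end Prog

theorem VATA.polyTimeComputable_sentence :
    PolyTimeComputable VATA.encode C2Sentence.encode VATA.sentence := by
  obtain ⟨n, l, hl⟩ : ∃ (n : ℕ) (l : List CodeSym), l.length = n ∧ ∀ a, a ∈ l := by
    have := Fintype.ofFinite CodeSym
    exact ⟨_, Finset.univ.toList, rfl, by simp⟩
  refine ⟨Prog.seq Prog.writeFormula (Prog.moveOutput l),
    (Polynomial.C (n + 4)) * ((Polynomial.C 42 * Polynomial.X + Polynomial.C 600) * Polynomial.X)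
      + 1, fun A => ?_⟩
  have h1 := Prog.runsWithin_writeFormula A le_rfl
  -- Stack `1` starts empty, so the output is no longer than the time spent writing it.
  have hlen : A.formula.encode.length ≤ (42 * A.encode.length + 600) * A.encode.length := by
    obtain ⟨t, ht, h⟩ := h1
    have := h.length_le 1
    simp only [memory, List.reverse_nil, List.length_nil, List.length_reverse] at this
    omega
  obtain ⟨t, ht, h⟩ := h1.seq (Prog.runsWithin_moveOutput hl.2 A.formula.encode [])
  have hs : Prog.start A.encode = memory A.encode [] 0 0 0 0 := by
    funext r
    rcases r with _ | _ | _ | _ | _ | _ | r <;> rfl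
  refine ⟨_, t, hs ▸ h, ?_, ht.trans ?_⟩
  · simp [memory, C2Sentence.encode, VATA.sentence]
  · simp only [Polynomial.eval_add, Polynomial.eval_mul, Polynomial.eval_C, Polynomial.eval_X,
      Polynomial.eval_one, hl.1]
    have := Nat.mul_le_mul_left (n + 3) hlen
    linarith

namespace TreeStructure

variable (T : TreeStructure)

/-! ## The meaning of the sentence -/

theorem sat_exactly {k : ℕ} {v : Var} {φ : C2Formula} {e : Var → T.dom} :
    T.Sat (exactly k v φ) e ↔ Set.ncard {a | T.Sat φ (Function.update e v a)} = k :=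
  ⟨fun h => le_antisymm h.2 h.1, fun h => ⟨h.ge, h.le⟩⟩

theorem sat_indexedAnd_ofFn {α : Type} (F : ℕ → α → C2Formula) {φ : C2Formula}
    {e : Var → T.dom} {n : ℕ} (f : Fin n → α) (j : ℕ) :
    T.Sat (indexedAnd F j (List.ofFn f) φ) e ↔
      (∀ i : Fin n, T.Sat (F (j + i) (f i)) e) ∧ T.Sat φ e := by
  induction n generalizing j with
  | zero => simp [indexedAnd]
  | succ n ih =>
    rw [List.ofFn_succ, indexedAnd, Sat, ih, Fin.forall_fin_succ, and_assoc]
    simp [add_assoc, add_comm 1]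

theorem sat_listOr {α : Type} (F : α → C2Formula) {φ : C2Formula} {e : Var → T.dom}
    (l : List α) : T.Sat (listOr F l φ) e ↔ (∃ a ∈ l, T.Sat (F a) e) ∨ T.Sat φ e := by
  induction l with
  | nil => simp [listOr]
  | cons a l ih => simp [listOr, Sat, ih, or_assoc]

/-- The node `u` represents a step of the run. -/
def Run (u : T.dom) : Prop := T.unary 0 u

/-- The number of leaves of kind `s` attached to `u`. -/
noncomputable def numAttached (s : ℕ) (u : T.dom) : ℕ :=
  Set.ncard {t | T.Child u t ∧ ¬ T.Run t ∧ T.unary s t}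

/-- The number of leaves of kind `s` consumed at `u`. -/
noncomputable def numConsumed (s : ℕ) (u : T.dom) : ℕ :=
  Set.ncard {t | T.common 0 t u ∧ T.unary s t}

/-- The position of `u` among the arguments of a step. -/
noncomputable def index (u : T.dom) : ℕ := Set.ncard {t | T.common 1 t u}

/-- The node `w` represents an application of the rule `r`. -/
structure IsStep {m : ℕ} {rank : Fin m → ℕ} {numStates dim : ℕ}
    (r : VATARule rank numStates dim) (w : T.dom) : Prop where
  source (i : Fin (rank r.symbol)) : ∃ u, T.Child w u ∧ T.Run u ∧ T.index u = i ∧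
    T.numAttached 1 u = r.source i
  arity : Set.ncard {u | T.Child w u ∧ T.Run u} = rank r.symbol
  loss (i : Fin (rank r.symbol)) : ∃ u, T.Child w u ∧ T.Run u ∧ T.index u = i ∧
    ∀ c : Fin dim, T.numConsumed (2 + c) u = r.loss i c
  target : T.numAttached 1 w = r.target
  gain (c : Fin dim) : T.numAttached (2 + c) w = r.gain c

/-- The tree represents an accepting run of `A`. -/
structure IsRun (A : VATA) : Prop where
  run_of_child (u w : T.dom) : T.Child u w → T.Run u
  desc_of_consumed (u w : T.dom) : T.common 0 u w → ¬ T.Run u ∧ Relation.TransGen T.Child w u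
  consumed_once (u : T.dom) : T.Run u ∨ Set.ncard {w | T.common 0 u w} = 1
  step (u : T.dom) : T.Run u → ∃ r ∈ A.rules, T.IsStep r u
  accept : ∃ u, T.Run u ∧ (¬ ∃ w, T.Child w u) ∧ ∃ c ∈ A.accepting,
    T.numAttached 1 u = c.1 ∧ ∀ i : Fin A.dim, T.numConsumed (2 + i) u = c.2 i

theorem sat_ruleFormula {m : ℕ} {rank : Fin m → ℕ} {numStates dim : ℕ}
    (r : VATARule rank numStates dim) {e : Var → T.dom} (he : T.Run (e .x)) :
    T.Sat r.formula e ↔ T.IsStep r (e .x) := by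
  have hiff : T.IsStep r (e .x) ↔
    (∀ i : Fin (rank r.symbol), ∃ u, T.Child (e .x) u ∧ T.Run u ∧ T.index u = i ∧
    T.numAttached 1 u = r.source i) ∧
    Set.ncard {u | T.Child (e .x) u ∧ T.Run u} = rank r.symbol ∧
    (∀ i : Fin (rank r.symbol), ∃ u, T.Child (e .x) u ∧ T.Run u ∧ T.index u = i ∧
      ∀ c : Fin dim, T.numConsumed (2 + c) u = r.loss i c) ∧
    T.numAttached 1 (e .x) = r.target ∧
    ∀ c : Fin dim, T.numAttached (2 + c) (e .x) = r.gain c :=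
    ⟨fun h => ⟨h.1, h.2, h.3, h.4, h.5⟩, fun h => ⟨h.1, h.2.1, h.2.2.1, h.2.2.2.1, h.2.2.2.2⟩⟩
  rw [hiff]
  simp only [VATARule.formula, ruleStep, sat_indexedAnd_ofFn, Sat, argument, sat_exactly,
    consumption, consumed, attached, run, navRel, Function.update_self,
    zero_add, List.length_ofFn, numAttached, numConsumed, index, Run,
    Function.update_of_ne (show Var.x ≠ Var.y by decide),
    Function.update_of_ne (show Var.y ≠ Var.x by decide)]
  have : T.unary 0 (e .x) := he
  simp only [this, and_true]
  -- Only the loss clause differs: `consumption` ends with a conjunct that is already known for the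
  -- argument.
  refine and_congr Iff.rfl (and_congr Iff.rfl (and_congr ?_ Iff.rfl))
  refine forall_congr' fun i => exists_congr fun u => and_congr_right fun _ =>
    and_congr_right fun hu => ?_
  simp [hu]

theorem sat_formula (A : VATA) (e : Var → T.dom) : T.Sat A.formula e ↔ T.IsRun A := by
  have hiff : T.IsRun A ↔ (∀ u w, T.Child u w → T.Run u) ∧
    (∀ u w, T.common 0 u w → ¬ T.Run u ∧ Relation.TransGen T.Child w u) ∧
    (∀ u, T.Run u ∨ Set.ncard {w | T.common 0 u w} = 1) ∧
    (∀ u, T.Run u → ∃ r ∈ A.rules, T.IsStep r u) ∧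
    ∃ u, T.Run u ∧ (¬ ∃ w, T.Child w u) ∧ ∃ c ∈ A.accepting,
      T.numAttached 1 u = c.1 ∧ ∀ i : Fin A.dim, T.numConsumed (2 + i) u = c.2 i :=
    ⟨fun h => ⟨h.1, h.2, h.3, h.4, h.5⟩, fun h => ⟨h.1, h.2.1, h.2.2.1, h.2.2.2.1, h.2.2.2.2⟩⟩
  rw [hiff]
  simp only [VATA.formula, configuration, consumption, consumed, attached, run, Sat, navRel,
    sat_listOr, sat_exactly, sat_indexedAnd_ofFn, Function.update_self,
    numAttached, numConsumed,
    Function.update_of_ne (show Var.x ≠ Var.y by decide)]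
  refine and_congr ?_ (and_congr ?_ (and_congr Iff.rfl (and_congr ?_ ?_)))
  · exact forall_congr' fun u => forall_congr' fun w => imp_iff_not_or.symm
  · exact forall_congr' fun u => forall_congr' fun w => imp_iff_not_or.symm
  · refine forall_congr' fun u => ?_
    -- The last disjunct turns the disjunction over the rules into an implication that is void at
    -- leaves.
    by_cases hu : T.Run u
    · have hu' : T.unary 0 u := hu
      simp only [hu', not_true_eq_false, or_false, hu, true_imp_iff]
      refine exists_congr fun r => and_congr_right fun _ => ?_
      exact T.sat_ruleFormula r (e := Function.update e .x u) (by simpa using hu)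
    · have hu' : ¬ T.unary 0 u := hu
      simp [hu, hu']
  · refine exists_congr fun u => and_congr_right fun hu => and_congr_right fun _ => ?_
    have hu' : T.unary 0 u := hu
    simp only [hu', not_true_eq_false, or_false, and_true]
    rfl

/-! ## Runs from models -/

variable {T}

theorem prefix_of_desc {u w : T.dom} (h : Relation.TransGen T.Child u w) :
    u.1 <+: w.1 ∧ u.1 ≠ w.1 := by
  -- Strict growth of length, unlike mere inequality, is preserved along a chain of children.
  suffices u.1 <+: w.1 ∧ u.1.length < w.1.length from ⟨this.1, fun e => by simp [e] at this⟩
  induction h with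
  | single h =>
    obtain ⟨i, hi⟩ := h
    simp [hi]
  | tail _ h ih =>
    obtain ⟨i, hi⟩ := h
    rw [hi]
    exact ⟨ih.1.trans (List.prefix_append _ _), by simp; omega⟩

end TreeStructure

/-! ### Counter values as numbers of pending tokens -/

namespace TreeStructure

variable {T : TreeStructure}

theorem mem_of_append {p : List ℕ} (q : List ℕ) (h : p ++ q ∈ T.dom) : p ∈ T.dom := by
  induction q using List.reverseRecOn with
  | nil => simpa using h
  | append_singleton q i ih => exact ih (T.parent_mem _ i (by simpa using h))

variable (T) in
/-- The leaves of kind `s` below `u` which are consumed at `w` or above. -/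
def pendingAt (s : ℕ) (w u : T.dom) : Set T.dom :=
  {t | T.unary s t ∧ ¬ T.Run t ∧ u.1 <+: t.1 ∧ u ≠ t ∧ ∃ v, T.common 0 t v ∧ v.1 <+: w.1}

namespace IsRun

variable {A : VATA}

theorem consumer_unique (hT : T.IsRun A) {t v v' : T.dom} (ht : ¬ T.Run t) (h : T.common 0 t v)
    (h' : T.common 0 t v') : v = v' := by
  obtain ⟨a, ha⟩ := Set.ncard_eq_one.1 ((hT.consumed_once t).resolve_left ht)
  have h1 : v ∈ ({a} : Set T.dom) := ha ▸ h
  have h2 : v' ∈ ({a} : Set T.dom) := ha ▸ h'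
  exact h1.trans h2.symm

theorem exists_consumer (hT : T.IsRun A) {t : T.dom} (ht : ¬ T.Run t) :
    ∃ v, T.common 0 t v := by
  obtain ⟨a, ha⟩ := Set.ncard_eq_one.1 ((hT.consumed_once t).resolve_left ht)
  exact ⟨a, (ha.symm ▸ rfl : a ∈ {w | T.common 0 t w})⟩

/-- The nodes at or above `u` are `u` itself and those at or above its parent `w`. As each leaf has
one consumer, the pending leaves split disjointly into those consumed at `u` and those surviving to
`w`. This is the subtraction of the loss. -/
theorem ncard_pendingAt_self (hT : T.IsRun A) (s : ℕ) {w u : T.dom} (h : T.Child w u) :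
    (T.pendingAt s u u).ncard = (T.pendingAt s w u).ncard + T.numConsumed s u := by
  obtain ⟨i, hi⟩ := h
  have key : T.pendingAt s u u = T.pendingAt s w u ∪ {t | T.common 0 t u ∧ T.unary s t} := by
    ext t
    constructor
    · rintro ⟨h1, h2, h3, h4, v, h5, h6⟩
      rw [hi, List.prefix_concat_iff, ← hi] at h6
      rcases h6 with h6 | h6
      · rw [Subtype.ext h6] at h5
        exact Or.inr ⟨h5, h1⟩
      · exact Or.inl ⟨h1, h2, h3, h4, v, h5, h6⟩
    · rintro (⟨h1, h2, h3, h4, v, h5, h6⟩ | ⟨h1, h2⟩)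
      · exact ⟨h1, h2, h3, h4, v, h5, h6.trans (hi ▸ List.prefix_append _ _)⟩
      · obtain ⟨h3, h4⟩ := hT.desc_of_consumed _ _ h1
        obtain ⟨h5, h6⟩ := prefix_of_desc h4
        exact ⟨h2, h3, h5, fun e => h6 (congrArg _ e), u, h1, List.prefix_rfl⟩
  rw [key, Set.ncard_union_eq ?_ (Set.toFinite _) (Set.toFinite _)]
  · rfl
  · rw [Set.disjoint_left]
    rintro t ⟨h1, h2, h3, h4, v, h5, h6⟩ ⟨h7, -⟩
    obtain rfl := hT.consumer_unique h2 h5 h7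
    have := h6.length_le
    simp [hi] at this

/-- A pending leaf below `w` is a child of `w` or lies below a child that has a child itself and
hence is one of the `u i`. Conversely, a leaf attached to `w` is consumed at a proper ancestor, so
at `w` or above, and is always pending. -/
theorem ncard_pendingAt_eq_sum (hT : T.IsRun A) (s : ℕ) {w : T.dom} {n : ℕ} (u : Fin n → T.dom)
    (hu : Function.Injective u) (hchild : ∀ i, T.Child w (u i))
    (hall : ∀ v, T.Child w v → T.Run v → ∃ i, u i = v) :
    (T.pendingAt s w w).ncard = ∑ i, (T.pendingAt s w (u i)).ncard + T.numAttached s w := by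
  have key : T.pendingAt s w w = (⋃ i, T.pendingAt s w (u i)) ∪
      {t | T.Child w t ∧ ¬ T.Run t ∧ T.unary s t} := by
    ext t
    simp only [Set.mem_union, Set.mem_iUnion]
    constructor
    · rintro ⟨h1, h2, ⟨l, h3⟩, h4, v, h5, h6⟩
      rcases l with _ | ⟨j, l⟩
      · exact absurd (Subtype.ext (by simpa using h3)) h4
      · have hm : w.1 ++ [j] ++ l ∈ T.dom := by
          have := t.2
          rw [← h3] at this
          simpa using this
        let v' : T.dom := ⟨w.1 ++ [j], mem_of_append l hm⟩
        have hc : T.Child w v' := ⟨j, rfl⟩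
        rcases l with _ | ⟨k, l⟩
        · exact Or.inr ⟨⟨j, h3.symm⟩, h2, h1⟩
        · have hr : T.Run v' := hT.run_of_child v'
            ⟨w.1 ++ [j] ++ [k], mem_of_append l (by simpa using hm)⟩ ⟨k, rfl⟩
          obtain ⟨i, hi⟩ := hall v' hc hr
          refine Or.inl ⟨i, h1, h2, ?_, ?_, v, h5, h6⟩
          · rw [hi, ← h3]
            exact ⟨k :: l, by simp [v']⟩
          · rw [hi]
            intro e
            exact h2 (e ▸ hr)
    · rintro (⟨i, h1, h2, h3, h4, v, h5, h6⟩ | ⟨h1, h2, h3⟩)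
      · obtain ⟨j, hj⟩ := hchild i
        refine ⟨h1, h2, (hj ▸ List.prefix_append _ _ : w.1 <+: (u i).1).trans h3, ?_, v, h5, h6⟩
        rintro rfl
        have := h3.length_le
        simp [hj] at this
      · obtain ⟨j, hj⟩ := h1
        obtain ⟨v, hv⟩ := hT.exists_consumer h2
        obtain ⟨h5, h6⟩ := prefix_of_desc (hT.desc_of_consumed _ _ hv).2
        refine ⟨h3, h2, hj ▸ List.prefix_append _ _, ?_, v, hv, ?_⟩
        · rintro rfl
          simp at hj
        · rw [hj, List.prefix_concat_iff, ← hj] at h5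
          exact h5.resolve_left h6
  rw [key, Set.ncard_union_eq ?_ (Set.toFinite _) (Set.toFinite _),
    Set.ncard_iUnion_of_finite (fun _ => Set.toFinite _), finsum_eq_sum_of_fintype]
  · rfl
  · intro i j hij
    rw [Function.onFun, Set.disjoint_left]
    rintro t ⟨-, -, h3, -⟩ ⟨-, -, h3', -⟩
    obtain ⟨a, ha⟩ := hchild i
    obtain ⟨b, hb⟩ := hchild j
    refine hij (hu (Subtype.ext ?_))
    exact (List.prefix_of_prefix_length_le h3 h3' (by simp [ha, hb])).eq_of_length
      (by simp [ha, hb])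
  · rw [Set.disjoint_left]
    rintro t ht ⟨⟨k, hk⟩, h2, -⟩
    obtain ⟨i, -, -, h3, h4, -⟩ := Set.mem_iUnion.1 ht
    obtain ⟨a, ha⟩ := hchild i
    exact h4 (Subtype.ext (h3.eq_of_length (by simp [ha, hk])))

/-- The number `n` bounds the height below `w` and drives the induction. The two counting lemmas
turn the step condition at `w` into an application of the rule. -/
theorem reaches (hT : T.IsRun A) (n : ℕ) (w : T.dom) (hw : T.Run w)
    (hn : ∀ t : T.dom, w.1 <+: t.1 → t.1.length < w.1.length + n) :
    ∃ t q, A.Reaches t q (fun c => (T.pendingAt (2 + c) w w).ncard) ∧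
      (q : ℕ) = T.numAttached 1 w := by
  induction n generalizing w with
  | zero => exact absurd (hn w List.prefix_rfl) (by simp)
  | succ n ih =>
    obtain ⟨r, hr, hstep⟩ := hT.step w hw
    choose u hchild hrun hindex hstate using hstep.source
    have hu : Function.Injective u := fun i j h => Fin.ext (by rw [← hindex, ← hindex, h])
    -- The indices make the chosen children distinct, and by the arity clause they are then all the
    -- run children.
    have hrange : Set.range u = {u | T.Child w u ∧ T.Run u} := by
      refine Set.eq_of_subset_of_ncard_le ?_ ?_ (Set.toFinite _)
      · rintro _ ⟨i, rfl⟩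
        exact ⟨hchild i, hrun i⟩
      · rw [hstep.arity, ← Set.image_univ, Set.ncard_image_of_injective _ hu]
        simp
    have hall : ∀ v, T.Child w v → T.Run v → ∃ i, u i = v := fun v h1 h2 =>
      hrange.symm.subset ⟨h1, h2⟩
    -- The loss clause provides its own child of index `i`; as there is only one, it is the child
    -- given by the source clause.
    have hloss : ∀ i (c : Fin A.dim), T.numConsumed (2 + c) (u i) = r.loss i c := by
      intro i c
      obtain ⟨v, hv, hv', hvi, h⟩ := hstep.loss i
      obtain ⟨j, rfl⟩ := hall v hv hv'
      obtain rfl : j = i := Fin.ext (by rw [← hvi, hindex])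
      exact h c
    have hsub := fun i => ih (u i) (hrun i) (fun t ht => by
      obtain ⟨j, hj⟩ := hchild i
      have := hn t ((hj ▸ List.prefix_append _ _ : w.1 <+: (u i).1).trans ht)
      simp only [hj, List.length_append, List.length_singleton]
      omega)
    choose ts qs hreach hq using hsub
    have hqs : ∀ i, qs i = r.source i := fun i => Fin.ext (by rw [hq, hstate])
    refine ⟨.node r.symbol ts, r.target, ?_, hstep.target.symm⟩
    convert VATA.Reaches.step r hr ts (fun i c => (T.pendingAt (2 + c) (u i) (u i)).ncard)
      (fun i => hqs i ▸ hreach i) (fun i c => ?_) using 1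
    · funext c
      rw [hT.ncard_pendingAt_eq_sum (2 + c) u hu hchild hall, ← hstep.gain c]
      congr 1
      refine Finset.sum_congr rfl fun i _ => ?_
      rw [hT.ncard_pendingAt_self _ (hchild i), ← hloss i c, Nat.add_sub_cancel]
    · rw [hT.ncard_pendingAt_self _ (hchild i), ← hloss i c]
      exact Nat.le_add_left _ _

theorem nonEmpty (hT : T.IsRun A) : A.NonEmpty := by
  obtain ⟨w, hw, hroot, c, hc, hstate, hcons⟩ := hT.accept
  have hnil : w.1 = [] := by
    rcases List.eq_nil_or_concat w.1 with h | ⟨p, i, h⟩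
    · exact h
    · refine absurd ⟨⟨p, T.parent_mem p i ?_⟩, i, by simpa using h⟩ hroot
      have := w.2
      simpa [h] using this
  obtain ⟨t, q, hreach, hq⟩ := hT.reaches (T.dom.sup List.length + 1) w hw (fun t _ => by
    have := Finset.le_sup (f := List.length) t.2
    omega)
  obtain rfl : q = c.1 := Fin.ext (hq.trans hstate)
  refine ⟨t, c, hc, ?_⟩
  -- Nothing lies above the root, so its pending tokens are precisely those it consumes.
  convert hreach using 1
  funext i
  rw [← hcons i, numConsumed]
  congr 1
  ext t
  constructor
  · rintro ⟨h1, h2⟩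
    obtain ⟨h3, h4⟩ := hT.desc_of_consumed _ _ h1
    obtain ⟨h5, h6⟩ := prefix_of_desc h4
    exact ⟨h2, h3, h5, fun e => h6 (congrArg _ e), w, h1, List.prefix_rfl⟩
  · rintro ⟨h1, -, -, -, v, h5, h6⟩
    rw [hnil, List.prefix_nil] at h6
    obtain rfl : v = w := Subtype.ext (h6.trans hnil.symm)
    exact ⟨h5, h1⟩

end IsRun

end TreeStructure

/-! ## Labellings of trees -/

/-- The label of a tree node: a step of the run, or a leaf of kind `s` to be consumed `h + 1` levels
above. -/
inductive NodeLabel : Type where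
  | runNode
  | leaf (s h : ℕ)

/-- Trees with labelled nodes; there is a node where the value is not `none`. -/
abbrev Labelling : Type := List ℕ → Option NodeLabel

namespace Labelling

open NodeLabel

/-- The leaves of kind `s` to be consumed `h` levels above the root. -/
def pending (L : Labelling) (s h : ℕ) : Set (List ℕ) :=
  {q | ∃ k, L q = some (leaf s k) ∧ k + 1 = q.length + h}

/-- The leaves of kind `s` attached to the root. -/
def attached (L : Labelling) (s : ℕ) : Set ℕ := {j | ∃ k, L [j] = some (leaf s k)}

/-- The root is a step with the rule `r`. -/
structure IsStep {m : ℕ} {rank : Fin m → ℕ} {numStates dim : ℕ}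
    (r : VATARule rank numStates dim) (L : Labelling) : Prop where
  run_iff (j : ℕ) : L [j] = some runNode ↔ j < rank r.symbol
  source (i : Fin (rank r.symbol)) : (attached (fun q => L (i :: q)) 1).ncard = r.source i
  loss (i : Fin (rank r.symbol)) (c : Fin dim) :
    (pending (fun q => L (i :: q)) (2 + c) 0).ncard = r.loss i c
  target : (attached L 1).ncard = r.target
  gain (c : Fin dim) : (attached L (2 + c)).ncard = r.gain c

/-- The labelling is a run of `A` with some counters. -/
structure IsRun (A : VATA) (L : Labelling) : Prop where
  finite : {p | L p ≠ none}.Finite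
  root : L [] = some runNode
  parent (p : List ℕ) (i : ℕ) : L (p ++ [i]) ≠ none → L p = some runNode
  left (p : List ℕ) (i : ℕ) : L (p ++ [i + 1]) ≠ none → L (p ++ [i]) ≠ none
  step (p : List ℕ) : L p = some runNode → ∃ r ∈ A.rules, IsStep r fun q => L (p ++ q)

theorem IsRun.finite_pending {A : VATA} {L : Labelling} (h : IsRun A L) (s k : ℕ) :
    (pending L s k).Finite :=
  h.finite.subset (by rintro q ⟨l, hl, -⟩; simp [hl])

/-! ### Gluing labelled trees below a new root -/

/-- The tree with given subtrees and leaves below a root. -/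
def glue {n : ℕ} (K : Fin n → Labelling) (l : List (ℕ × ℕ)) : Labelling
  | [] => some runNode
  | j :: q => if h : j < n then K ⟨j, h⟩ q else
      if q = [] then (l[j - n]?).map fun a => leaf a.1 a.2 else none

section glue

variable {n : ℕ} (K : Fin n → Labelling) (l : List (ℕ × ℕ))

theorem glue_fin (i : Fin n) (q : List ℕ) : glue K l (i :: q) = K i q := by
  simp [glue]

theorem glue_leaf (j : ℕ) : glue K l [n + j] = (l[j]?).map fun a => leaf a.1 a.2 := by
  simp [glue]

theorem glue_cons (j : ℕ) (q : List ℕ) (h : glue K l (j :: q) ≠ none) :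
    (∃ i : Fin n, j = i ∧ glue K l (j :: q) = K i q) ∨
      ∃ k, j = n + k ∧ q = [] ∧ ∃ a, l[k]? = some a ∧
        glue K l (j :: q) = some (leaf a.1 a.2) := by
  by_cases hj : j < n
  · exact Or.inl ⟨⟨j, hj⟩, rfl, glue_fin K l ⟨j, hj⟩ q⟩
  · obtain ⟨k, rfl⟩ := Nat.exists_eq_add_of_le (not_lt.1 hj)
    by_cases hq : q = []
    · subst hq
      rw [glue_leaf] at h ⊢
      cases ha : l[k]? with
      | none => simp [ha] at h
      | some a => exact Or.inr ⟨k, rfl, rfl, a, ha, rfl⟩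
    · simp [glue, hq] at h

end glue

theorem ncard_getElem?_eq_countP {α : Type} (P : α → Prop) [DecidablePred P] (l : List α) :
    Set.ncard {j : ℕ | ∃ a, l[j]? = some a ∧ P a} = l.countP P := by
  induction l with
  | nil => simp
  | cons b l ih =>
    have hfin : {j : ℕ | ∃ a, l[j]? = some a ∧ P a}.Finite :=
      (Set.finite_Iio l.length).subset (by
        rintro j ⟨a, ha, -⟩
        exact (List.getElem?_eq_some_iff.1 ha).1)
    have key : {j : ℕ | ∃ a, (b :: l)[j]? = some a ∧ P a} =
        Nat.succ '' {j : ℕ | ∃ a, l[j]? = some a ∧ P a} ∪ {j : ℕ | j = 0 ∧ P b} := by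
      ext j
      cases j <;> simp
    rw [key, Set.ncard_union_eq ?_ (hfin.image _) ((Set.finite_singleton 0).subset (by
      rintro j ⟨h, -⟩; exact h)), Set.ncard_image_of_injective _ Nat.succ_injective, ih,
      List.countP_cons]
    · by_cases hb : P b <;> simp [hb]
    · rw [Set.disjoint_left]
      rintro _ ⟨j, -, rfl⟩ ⟨h, -⟩
      simp at h

/-- The roots of the subtrees are steps, so only entries of `l` can be attached leaves. -/
theorem ncard_attached_glue {n : ℕ} {K : Fin n → Labelling} (hK : ∀ i, K i [] = some runNode)
    (l : List (ℕ × ℕ)) (s : ℕ) :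
    (attached (glue K l) s).ncard = l.countP (fun a => a.1 = s) := by
  rw [← ncard_getElem?_eq_countP]
  refine (congrArg Set.ncard ?_).trans (Set.ncard_image_of_injective _ (add_right_injective n))
  ext j
  constructor
  · rintro ⟨k, hk⟩
    rcases glue_cons K l j [] (by simp [hk]) with ⟨i, rfl, h⟩ | ⟨m, rfl, -, a, ha, h⟩
    · simp [hk, hK] at h
    · rw [hk] at h
      simp only [Option.some.injEq, leaf.injEq] at h
      exact ⟨m, ⟨a, ha, h.1.symm⟩, rfl⟩
  · rintro ⟨m, ⟨a, ha, rfl⟩, rfl⟩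
    exact ⟨a.2, by simp [glue_leaf, ha]⟩

/-- The root of a subtree is one level lower, so distance `h` above the new root is distance `h + 1`
above the old one. A new leaf has depth one, and its label is then `h` itself. -/
theorem ncard_pending_glue {n : ℕ} {K : Fin n → Labelling} {s h : ℕ}
    (hfin : ∀ i, (pending (K i) s (h + 1)).Finite) (l : List (ℕ × ℕ)) :
    (pending (glue K l) s h).ncard =
      ∑ i, (pending (K i) s (h + 1)).ncard + l.countP (fun a => a = (s, h)) := by
  have key : pending (glue K l) s h = (⋃ i : Fin n, List.cons (i : ℕ) '' pending (K i) s (h + 1)) ∪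
      (fun j => [n + j]) '' {j : ℕ | ∃ a, l[j]? = some a ∧ a = (s, h)} := by
    ext q
    simp only [Set.mem_union, Set.mem_iUnion]
    constructor
    · rintro ⟨k, hk, hlen⟩
      rcases q with _ | ⟨j, q⟩
      · simp [glue] at hk
      · rcases glue_cons K l j q (by simp [hk]) with ⟨i, rfl, e⟩ | ⟨m, rfl, rfl, a, ha, e⟩
        · refine Or.inl ⟨i, q, ⟨k, e ▸ hk, ?_⟩, rfl⟩
          simp only [List.length_cons] at hlen
          omega
        · rw [hk] at e
          simp only [Option.some.injEq, leaf.injEq] at e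
          simp only [List.length_cons, List.length_nil] at hlen
          refine Or.inr ⟨m, ⟨a, ha, Prod.ext e.1.symm ?_⟩, rfl⟩
          simp only
          omega
    · rintro (⟨i, q, ⟨k, hk, hlen⟩, rfl⟩ | ⟨m, ⟨a, ha, rfl⟩, rfl⟩)
      · refine ⟨k, by rw [glue_fin]; exact hk, ?_⟩
        simp only [List.length_cons]
        omega
      · refine ⟨h, by simp [glue_leaf, ha], ?_⟩
        simp only [List.length_cons, List.length_nil]
        omega
  have hfin' : {j : ℕ | ∃ a, l[j]? = some a ∧ a = (s, h)}.Finite :=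
    (Set.finite_Iio l.length).subset (by
      rintro j ⟨a, ha, -⟩
      exact (List.getElem?_eq_some_iff.1 ha).1)
  rw [key, Set.ncard_union_eq ?_ (Set.finite_iUnion fun i => (hfin i).image _) (hfin'.image _),
    Set.ncard_iUnion_of_finite (fun i => (hfin i).image _), finsum_eq_sum_of_fintype,
    Set.ncard_image_of_injective _ (fun a b h => by simpa using h), ncard_getElem?_eq_countP]
  · congr 1
    exact Finset.sum_congr rfl fun i _ =>
      Set.ncard_image_of_injective _ List.cons_injective
  · intro i j hij
    rw [Function.onFun, Set.disjoint_left]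
    rintro _ ⟨q, -, rfl⟩ ⟨q', -, e⟩
    simp only [List.cons.injEq] at e
    exact hij (Fin.ext e.1.symm)
  · rw [Set.disjoint_left]
    rintro _ hq ⟨j, -, rfl⟩
    obtain ⟨i, q, -, e⟩ := Set.mem_iUnion.1 hq
    simp only [List.cons.injEq] at e
    omega

/-- The rule has to be checked only at the new root. Conditions inside a subtree depend on labels
relative to their leaves and survive gluing unchanged. -/
theorem isRun_glue {A : VATA} (r : VATARule A.rank A.numStates A.dim) (hr : r ∈ A.rules)
    {K : Fin (A.rank r.symbol) → Labelling} (hK : ∀ i, IsRun A (K i)) (l : List (ℕ × ℕ))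
    (hsource : ∀ i, (attached (K i) 1).ncard = r.source i)
    (hloss : ∀ i (c : Fin A.dim), (pending (K i) (2 + c) 0).ncard = r.loss i c)
    (htarget : l.countP (fun a => a.1 = 1) = r.target)
    (hgain : ∀ c : Fin A.dim, l.countP (fun a => a.1 = 2 + (c : ℕ)) = r.gain c) :
    IsRun A (glue K l) where
  finite := by
    refine Set.Finite.subset (((Set.finite_singleton ([] : List ℕ)).union
      (Set.finite_iUnion fun i : Fin _ => (hK i).finite.image (List.cons (i : ℕ)))).union
      ((Set.finite_Iio l.length).image fun j => [A.rank r.symbol + j])) ?_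
    rintro (_ | ⟨j, q⟩) hq
    · exact Or.inl (Or.inl rfl)
    · rcases glue_cons K l j q hq with ⟨i, rfl, e⟩ | ⟨m, rfl, rfl, a, ha, e⟩
      · refine Or.inl (Or.inr (Set.mem_iUnion.2 ⟨i, q, ?_, rfl⟩))
        rw [Set.mem_ofPred_eq, e] at hq
        exact hq
      · exact Or.inr ⟨m, (List.getElem?_eq_some_iff.1 ha).1, rfl⟩
  root := rfl
  parent := by
    rintro (_ | ⟨j, p⟩) i h
    · rfl
    · rcases glue_cons K l j (p ++ [i]) h with ⟨k, rfl, e⟩ | ⟨m, -, hp, -⟩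
      · rw [glue_fin]
        rw [List.cons_append, e] at h
        exact (hK k).parent p i h
      · simp at hp
  left := by
    rintro (_ | ⟨j, p⟩) i h
    · rcases lt_or_ge i (A.rank r.symbol) with hi | hi
      · have := glue_fin K l ⟨i, hi⟩ []
        simp only at this
        rw [List.nil_append, this, (hK _).root]
        simp
      · obtain ⟨k, rfl⟩ := Nat.exists_eq_add_of_le hi
        rw [List.nil_append, add_assoc, glue_leaf] at h
        rw [List.nil_append, glue_leaf]
        simp only [ne_eq, Option.map_eq_none_iff, List.getElem?_eq_none_iff, not_le] at h ⊢
        omega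
    · rcases glue_cons K l j (p ++ [i + 1]) h with ⟨k, rfl, e⟩ | ⟨m, -, hp, -⟩
      · rw [List.cons_append, glue_fin]
        rw [List.cons_append, e] at h
        exact (hK k).left p i h
      · simp at hp
  step := by
    rintro (_ | ⟨j, p⟩) h
    · refine ⟨r, hr, ?_⟩
      simp only [List.nil_append]
      have hsub : ∀ i : Fin (A.rank r.symbol), (fun q => glue K l (i :: q)) = K i :=
        fun i => funext (glue_fin K l i)
      have hroot := fun i => (hK i).root
      refine ⟨fun j => ⟨fun hj => ?_, fun hj => ?_⟩, fun i => ?_, fun i c => ?_, ?_, fun c => ?_⟩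
      · rcases glue_cons K l j [] (by simp [hj]) with ⟨k, rfl, -⟩ | ⟨m, rfl, -, a, ha, e⟩
        · exact k.2
        · simp [hj] at e
      · exact (glue_fin K l ⟨j, hj⟩ []).trans (hroot _)
      · rw [hsub, hsource]
      · rw [hsub, hloss]
      · rw [ncard_attached_glue hroot, htarget]
      · rw [ncard_attached_glue hroot, hgain]
    · rcases glue_cons K l j p (by simp [h]) with ⟨k, rfl, e⟩ | ⟨m, rfl, -, a, ha, e⟩
      · obtain ⟨r', hr', hstep⟩ := (hK k).step p (e ▸ h)
        refine ⟨r', hr', ?_⟩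
        simpa only [List.cons_append, glue_fin] using hstep
      · simp [h] at e

/-! ### Labellings from runs with prescribed consumption levels -/

theorem exists_multiset_sum_add {α : Type} {n : ℕ} (a : Fin n → ℕ) (H : Multiset α)
    (h : ∑ i, a i ≤ H.card) : ∃ (P : Fin n → Multiset α) (G : Multiset α),
      H = ∑ i, P i + G ∧ ∀ i, (P i).card = a i := by
  induction n generalizing H with
  | zero => exact ⟨Fin.elim0, H, by simp, fun i => i.elim0⟩
  | succ n ih =>
    rw [Fin.sum_univ_succ] at h
    obtain ⟨s, t, hs, rfl⟩ : ∃ s t : Multiset α, s.card = a 0 ∧ H = s + t := by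
      induction H using Quotient.inductionOn with
      | h l =>
        refine ⟨(l.take (a 0) : List α), (l.drop (a 0) : List α), ?_, ?_⟩
        · simp only [Multiset.quot_mk_to_coe, Multiset.coe_card, List.length_take] at h ⊢
          omega
        · simp
    obtain ⟨P, G, rfl, hP⟩ := ih (fun i => a i.succ) t (by rw [Multiset.card_add] at h; omega)
    refine ⟨Fin.cons s P, G, ?_, fun i => ?_⟩
    · simp [Fin.sum_univ_succ, add_assoc]
    · cases i using Fin.cases <;> simp [hs, hP]

theorem countP_sum {α ι : Type} (P : α → Prop) [DecidablePred P] (s : Finset ι)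
    (f : ι → Multiset α) : (∑ i ∈ s, f i).countP P = ∑ i ∈ s, (f i).countP P :=
  map_sum (Multiset.countPAddMonoidHom P) f s

/-- The multiset `H c` prescribes, for each token of counter `c` left at the root, how many levels
higher it is to be consumed. This freedom makes the induction work: the prescription is distributed
among the arguments and the new tokens, and the arguments receive prescriptions of their own. -/
theorem exists_isRun {A : VATA} {t : RankedTerm A.rank} {q : Fin A.numStates} {x : Fin A.dim → ℕ}
    (h : A.Reaches t q x) (H : Fin A.dim → Multiset ℕ) (hH : ∀ c, (H c).card = x c) :
    ∃ L : Labelling, IsRun A L ∧ (attached L 1).ncard = q ∧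
      ∀ (c : Fin A.dim) k, (pending L (2 + c) k).ncard = (H c).count k := by
  induction h generalizing H with
  | step r hr ts xs hreach hloss ih =>
    replace hH : ∀ c, (H c).card = ∑ i, (xs i c - r.loss i c) + r.gain c := hH
    have hsplit := fun c => exists_multiset_sum_add (fun i => xs i c - r.loss i c) (H c)
      (by rw [hH]; omega)
    choose P G hPG hP using hsplit
    have hG : ∀ c, (G c).card = r.gain c := by
      intro c
      have := hH c
      rw [hPG, Multiset.card_add, Multiset.card_sum] at this
      simp only [hP] at this
      omega
    -- Survivors of argument `i` have one level more to go; the tokens lost there are consumed at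
    -- the root of that argument, at distance `0`.
    have hsub := fun i => ih i
      (fun c => (P c i).map (· + 1) + Multiset.replicate (r.loss i c) 0) (fun c => by
        have := hloss i c
        simp only [Multiset.card_add, Multiset.card_map, Multiset.card_replicate, hP]
        omega)
    choose K hK hsource hpend using hsub
    -- Leaves giving the state also need a consumer; distance `0` sends them to their parent, and
    -- kind `1` keeps them out of every counter.
    let M : Multiset (ℕ × ℕ) := Multiset.replicate r.target (1, 0) +
      ∑ c : Fin A.dim, (G c).map fun k => (2 + (c : ℕ), k)
    have hM : ∀ (Q : ℕ × ℕ → Prop) [DecidablePred Q], M.toList.countP Q =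
        (if Q (1, 0) then (r.target : ℕ) else 0) +
          ∑ c : Fin A.dim, (G c).countP fun k => Q (2 + (c : ℕ), k) := by
      intro Q _
      rw [← Multiset.coe_countP, Multiset.coe_toList, Multiset.countP_add, countP_sum]
      congr 1
      · rw [← Multiset.coe_replicate, Multiset.coe_countP, List.countP_replicate]
        simp
      · refine Finset.sum_congr rfl fun c _ => ?_
        rw [Multiset.countP_map, Multiset.countP_eq_card_filter]
    have htarget : M.toList.countP (fun a => a.1 = 1) = r.target := by
      rw [hM]
      simp only [if_true, add_eq_left]
      refine Finset.sum_eq_zero fun c _ => ?_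
      rw [Multiset.countP_eq_zero]
      intro k _
      omega
    have hroot := fun i => (hK i).root
    refine ⟨glue K M.toList, isRun_glue r hr hK _ hsource (fun i c => ?_) htarget (fun c => ?_),
      ?_, fun c k => ?_⟩
    -- Shifted distances are positive, so only the lost tokens have distance `0`.
    · rw [hpend, Multiset.count_add, Multiset.count_replicate_self,
        Multiset.count_eq_zero_of_notMem (by simp), zero_add]
    · rw [hM, if_neg (by simp only; omega), zero_add, Finset.sum_eq_single c]
      · rw [← hG]
        simp
      · intro b _ hb
        rw [Multiset.countP_eq_zero]
        intro k _ e
        exact hb (Fin.ext (by simpa using e))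
      · simp
    · rw [ncard_attached_glue hroot, htarget]
    · rw [ncard_pending_glue (fun i => (hK i).finite_pending _ _), hM, if_neg (by simp; omega),
        zero_add, Finset.sum_eq_single c, hPG, Multiset.count_add, Multiset.count_sum']
      · congr 1
        · refine Finset.sum_congr rfl fun i _ => ?_
          rw [hpend, Multiset.count_add,
            Multiset.count_map_eq_count' _ _ (add_left_injective 1), Multiset.count_replicate]
          simp
        · simp [Multiset.count, eq_comm]
      · intro b _ hb
        rw [Multiset.countP_eq_zero]
        intro k _ e
        exact hb (Fin.ext (by simpa using congrArg Prod.fst e))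
      · simp

end Labelling

/-! ### The model defined by a labelling -/

namespace TreeStructure

theorem desc_of_append {T : TreeStructure} {u w : T.dom} (h : u.1 <+: w.1) (hne : u.1 ≠ w.1) :
    Relation.TransGen T.Child u w := by
  obtain ⟨w, hw⟩ := w
  simp only at h hne
  induction w using List.reverseRecOn with
  | nil => exact absurd (List.prefix_nil.1 h) hne
  | append_singleton p i ih =>
    have hp : p ∈ T.dom := T.parent_mem p i hw
    have hc : T.Child ⟨p, hp⟩ ⟨p ++ [i], hw⟩ := ⟨i, rfl⟩
    by_cases e : u.1 = p
    · obtain rfl : u = ⟨p, hp⟩ := Subtype.ext e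
      exact .single hc
    · exact .tail (ih hp ((List.prefix_concat_iff.1 h).resolve_left hne) e) hc

end TreeStructure

namespace Labelling

open NodeLabel

variable {A : VATA} {L : Labelling}

/-- The tree of a labelling. -/
noncomputable def IsRun.tree (hL : IsRun A L) : TreeStructure where
  dom := hL.finite.toFinset
  root_mem := by simp [hL.root]
  parent_mem u i h := by
    simp only [Set.Finite.mem_toFinset, Set.mem_ofPred_eq] at h ⊢
    simp [hL.parent u i h]
  left_mem u i h := by
    simp only [Set.Finite.mem_toFinset, Set.mem_ofPred_eq] at h ⊢
    exact hL.left u i h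
  unary s u := (s = 0 ∧ L u = some runNode) ∨ (s ≠ 0 ∧ ∃ k, L u = some (leaf s k))
  common n u w := (n = 0 ∧ ∃ s k, L u = some (leaf s k) ∧ w.1 = u.1.take (u.1.length - 1 - k)) ∨
    (n ≠ 0 ∧ ∃ p i j, u.1 = p ++ [i] ∧ w.1 = p ++ [j] ∧ i < j)

namespace IsRun

theorem mem_tree (hL : IsRun A L) {p : List ℕ} : p ∈ hL.tree.dom ↔ L p ≠ none := by
  simp [tree]

theorem run_iff (hL : IsRun A L) (u : hL.tree.dom) : hL.tree.Run u ↔ L u = some runNode := by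
  simp [TreeStructure.Run, tree]

theorem unary_iff (hL : IsRun A L) {s : ℕ} (hs : s ≠ 0) (u : hL.tree.dom) :
    hL.tree.unary s u ↔ ∃ k, L u = some (leaf s k) := by
  simp [tree, hs]

theorem common_zero_iff (hL : IsRun A L) (u w : hL.tree.dom) : hL.tree.common 0 u w ↔
    ∃ s k, L u = some (leaf s k) ∧ w.1 = u.1.take (u.1.length - 1 - k) := by
  simp [tree]

theorem common_one_iff (hL : IsRun A L) (u w : hL.tree.dom) : hL.tree.common 1 u w ↔
    ∃ p i j, u.1 = p ++ [i] ∧ w.1 = p ++ [j] ∧ i < j := by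
  simp [tree]

theorem numAttached_eq (hL : IsRun A L) {s : ℕ} (hs : s ≠ 0) (u : hL.tree.dom) :
    hL.tree.numAttached s u = (attached (fun q => L (u.1 ++ q)) s).ncard := by
  rw [TreeStructure.numAttached, ← Set.ncard_image_of_injective _ Subtype.val_injective]
  refine (congrArg Set.ncard ?_).trans (Set.ncard_image_of_injective (f := fun j => u.1 ++ [j]) _
    (fun a b h => by simpa using h))
  ext p
  constructor
  · rintro ⟨t, ⟨⟨j, hj⟩, -, ht⟩, rfl⟩
    obtain ⟨k, hk⟩ := (hL.unary_iff hs t).1 ht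
    exact ⟨j, ⟨k, by simp only [← hj]; exact hk⟩, hj.symm⟩
  · rintro ⟨j, ⟨k, hk⟩, rfl⟩
    simp only at hk
    refine ⟨⟨u.1 ++ [j], hL.mem_tree.2 (by simp [hk])⟩, ⟨⟨j, rfl⟩, ?_, ?_⟩, rfl⟩
    · simp [run_iff, hk]
    · exact (hL.unary_iff hs _).2 ⟨k, hk⟩

/-- Subtraction in the definition of the consumer is truncated: a leaf whose label points above the
root is consumed at the root. Such leaves would spoil the count at the root only, whence the two
alternatives in `hu`. -/
theorem numConsumed_eq (hL : IsRun A L) {s : ℕ} (hs : s ≠ 0) (u : hL.tree.dom)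
    (hu : u.1 ≠ [] ∨ ∀ p k, L p = some (leaf s k) → k + 1 ≤ p.length) :
    hL.tree.numConsumed s u = (pending (fun q => L (u.1 ++ q)) s 0).ncard := by
  rw [TreeStructure.numConsumed, ← Set.ncard_image_of_injective _ Subtype.val_injective]
  refine (congrArg Set.ncard ?_).trans (Set.ncard_image_of_injective (f := fun q => u.1 ++ q) _
    (List.append_right_injective _))
  ext p
  constructor
  · rintro ⟨t, ⟨h1, h2⟩, rfl⟩
    obtain ⟨s', k, hk, h3⟩ := (hL.common_zero_iff t u).1 h1
    obtain ⟨k', hk'⟩ := (hL.unary_iff hs t).1 h2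
    rw [hk] at hk'
    obtain ⟨rfl, rfl⟩ : s' = s ∧ k = k' := by simpa using hk'
    have hd := List.take_append_drop (t.1.length - 1 - k) t.1
    rw [← h3] at hd
    refine ⟨t.1.drop (t.1.length - 1 - k), ⟨k, ?_, ?_⟩, hd⟩
    · simp only [hd]
      exact hk
    · have hlen := congrArg List.length h3
      rw [List.length_take] at hlen
      rw [List.length_drop]
      have : k + 1 ≤ t.1.length := by
        rcases hu with hu | hu
        · have := List.length_pos_iff.2 hu
          omega
        · exact hu _ _ hk
      omega
  · rintro ⟨q, ⟨k, hk, hlen⟩, rfl⟩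
    simp only at hk
    refine ⟨⟨u.1 ++ q, hL.mem_tree.2 (by simp [hk])⟩, ⟨?_, (hL.unary_iff hs _).2 ⟨k, hk⟩⟩, rfl⟩
    refine (hL.common_zero_iff _ _).2 ⟨s, k, hk, ?_⟩
    rw [List.take_left' (by rw [List.length_append]; omega)]

/-- In this model common symbol `1` relates a node to the siblings on its right, and tree domains
are closed under left siblings. So exactly `i` nodes are related to child `i`. -/
theorem index_eq (hL : IsRun A L) (u : hL.tree.dom) {p : List ℕ} {i : ℕ} (hu : u.1 = p ++ [i]) :
    hL.tree.index u = i := by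
  rw [TreeStructure.index, ← Set.ncard_image_of_injective _ Subtype.val_injective]
  refine (congrArg Set.ncard ?_).trans ((Set.ncard_image_of_injective (f := fun j => p ++ [j])
    (Set.Iio i) (fun a b h => by simpa using h)).trans (by simp))
  ext q
  constructor
  · rintro ⟨t, ht, rfl⟩
    obtain ⟨p', a, b, h1, h2, h3⟩ := (hL.common_one_iff t u).1 ht
    rw [hu] at h2
    obtain ⟨rfl, rfl⟩ : p = p' ∧ i = b := by simpa using List.append_inj' h2 rfl
    exact ⟨a, h3, h1.symm⟩
  · rintro ⟨j, hj, rfl⟩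
    have hm : ∀ n, p ++ [j + n] ∈ hL.tree.dom → p ++ [j] ∈ hL.tree.dom := by
      intro n
      induction n with
      | zero => exact id
      | succ n ih => exact fun h => ih (hL.tree.left_mem p (j + n) h)
    have hj' : p ++ [j] ∈ hL.tree.dom := hm (i - j) (by
      rw [Nat.add_sub_cancel' (le_of_lt hj), ← hu]
      exact u.2)
    exact ⟨⟨p ++ [j], hj'⟩, (hL.common_one_iff _ _).2 ⟨p, j, i, rfl, hu, hj⟩, rfl⟩

theorem isStep (hL : IsRun A L) {r : VATARule A.rank A.numStates A.dim} (u : hL.tree.dom)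
    (h : IsStep r fun q => L (u.1 ++ q)) : hL.tree.IsStep r u := by
  have hmem : ∀ i, i < A.rank r.symbol → L (u.1 ++ [i]) = some runNode :=
    fun i hi => (h.run_iff i).2 hi
  let v : Fin (A.rank r.symbol) → hL.tree.dom :=
    fun i => ⟨u.1 ++ [(i : ℕ)], hL.mem_tree.2 (by simp [hmem i i.2])⟩
  have hrun : ∀ i, hL.tree.Run (v i) := fun i => (hL.run_iff _).2 (hmem i i.2)
  refine ⟨fun i => ⟨v i, ⟨i, rfl⟩, hrun i, hL.index_eq (v i) rfl, ?_⟩, ?_,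
    fun i => ⟨v i, ⟨i, rfl⟩, hrun i, hL.index_eq (v i) rfl, fun c => ?_⟩, ?_, fun c => ?_⟩
  · rw [hL.numAttached_eq one_ne_zero, ← h.source i]
    simp [v]
  · have : {w | hL.tree.Child u w ∧ hL.tree.Run w} = Set.range v := by
      ext w
      constructor
      · rintro ⟨⟨j, hj⟩, hw⟩
        rw [hL.run_iff, hj] at hw
        exact ⟨⟨j, (h.run_iff j).1 hw⟩, Subtype.ext hj.symm⟩
      · rintro ⟨i, rfl⟩
        exact ⟨⟨i, rfl⟩, hrun i⟩
    rw [this, ← Set.image_univ, Set.ncard_image_of_injective]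
    · simp
    · intro i j hij
      have := congrArg Subtype.val hij
      simpa [v, Fin.ext_iff] using this
  · rw [hL.numConsumed_eq (by omega) _ (Or.inl (by simp [v])), ← h.loss i c]
    simp [v]
  · rw [hL.numAttached_eq one_ne_zero, h.target]
  · rw [hL.numAttached_eq (by omega), h.gain]

theorem isRun_tree (hL : IsRun A L) {c : Fin A.numStates × (Fin A.dim → ℕ)} (hc : c ∈ A.accepting)
    (hstate : (Labelling.attached L 1).ncard = c.1)
    (hpend : ∀ (i : Fin A.dim) k, (pending L (2 + i) k).ncard =
      (Multiset.replicate (c.2 i) 0).count k) : hL.tree.IsRun A where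
  run_of_child := by
    rintro u w ⟨i, hi⟩
    refine (hL.run_iff u).2 (hL.parent u.1 i ?_)
    rw [← hi]
    exact hL.mem_tree.1 w.2
  desc_of_consumed := by
    intro u w h
    obtain ⟨s, k, hk, hw⟩ := (hL.common_zero_iff u w).1 h
    refine ⟨by simp [hL.run_iff, hk], TreeStructure.desc_of_append ?_ ?_⟩
    · rw [hw]
      exact ⟨_, List.take_append_drop _ _⟩
    · intro e
      have hu : u.1 ≠ [] := by
        intro hu
        rw [hu, hL.root] at hk
        simp at hk
      have := congrArg List.length hw
      have := List.length_pos_iff.2 hu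
      rw [e, List.length_take] at *
      omega
  consumed_once := by
    intro u
    by_cases h : hL.tree.Run u
    · exact Or.inl h
    · right
      obtain ⟨s, k, hk⟩ : ∃ s k, L u.1 = some (leaf s k) := by
        have h1 := hL.mem_tree.1 u.2
        rw [hL.run_iff] at h
        rcases hu : L u.1 with _ | _ | ⟨s, k⟩
        · exact absurd hu h1
        · exact absurd hu h
        · exact ⟨s, k, rfl⟩
      have hm : u.1.take (u.1.length - 1 - k) ∈ hL.tree.dom :=
        TreeStructure.mem_of_append (u.1.drop (u.1.length - 1 - k))
          (by rw [List.take_append_drop]; exact u.2)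
      refine Set.ncard_eq_one.2 ⟨⟨_, hm⟩, ?_⟩
      ext w
      simp only [Set.mem_ofPred_eq, Set.mem_singleton_iff]
      rw [hL.common_zero_iff]
      constructor
      · rintro ⟨s', k', hk', hw⟩
        rw [hk] at hk'
        obtain ⟨-, rfl⟩ : s = s' ∧ k = k' := by simpa using hk'
        exact Subtype.ext hw
      · rintro rfl
        exact ⟨s, k, hk, rfl⟩
  step := by
    intro u hu
    obtain ⟨r, hr, h⟩ := hL.step u.1 ((hL.run_iff u).1 hu)
    exact ⟨r, hr, hL.isStep u h⟩
  accept := by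
    refine ⟨⟨[], hL.tree.root_mem⟩, (hL.run_iff _).2 hL.root, ?_, c, hc, ?_, fun i => ?_⟩
    · rintro ⟨w, i, h⟩
      simp at h
    · rw [hL.numAttached_eq one_ne_zero, ← hstate]
      simp
    · rw [hL.numConsumed_eq (by omega)]
      · simpa using hpend i 0
      -- A leaf pointing above the root would be pending at a positive distance, but all prescribed
      -- distances are `0`.
      · right
        intro p k hk
        by_contra! hlt
        have h0 := hpend i (k + 1 - p.length)
        rw [Multiset.count_eq_zero_of_notMem (by
          intro h
          have := Multiset.eq_of_mem_replicate h
          omega), Set.ncard_eq_zero (hL.finite_pending _ _)] at h0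
        exact Set.notMem_empty p (h0 ▸ ⟨k, hk, by omega⟩)

end IsRun

end Labelling

/-! ### Correctness of the reduction -/

theorem VATA.nonEmpty_iff_satisfiable (A : VATA) : A.NonEmpty ↔ A.sentence.Satisfiable := by
  constructor
  · rintro ⟨t, c, hc, h⟩
    -- All tokens of the accepting configuration are to be consumed at the root itself.
    obtain ⟨L, hL, hstate, hpend⟩ := Labelling.exists_isRun h
      (fun i => Multiset.replicate (c.2 i) 0) (by simp)
    exact ⟨hL.tree, fun e => (hL.tree.sat_formula A e).2 (hL.isRun_tree hc hstate hpend)⟩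
  · rintro ⟨T, hT⟩
    exact ((T.sat_formula A fun _ => ⟨[], T.root_mem⟩).1 (hT _)).nonEmpty

theorem theorem7 :
    PolyTimeReducible VATA.encode C2Sentence.encode VATA.NonEmpty C2Sentence.Satisfiable :=
  ⟨VATA.sentence, VATA.polyTimeComputable_sentence, VATA.nonEmpty_iff_satisfiable⟩
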